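/- Let $X$ be a complex Banach space, let $d\ge 1$, $p_0\in(1,2]$, $p_0'=p_0/(p_0-1)$, and suppose that $X$ has Fourier type $p_0$ on $\mathbb{R}^d$, i.e. there is a constant $K$ with $\|\widehat g\|_{L^{p_0'}(\mathbb{R}^d;X)}\le K\|g\|_{L^{p_0}(\mathbb{R}^d;X)}$ for all $X$-valued Schwartz functions $g$, where $\widehat g(\xi)=\int_{\mathbb{R}^d} g(t)e^{-2\pi i t\cdot\xi}\,dt$. Let $p_0<q\le\infty$. For a strongly measurable $f:\mathbb{T}^d=(\mathbb{R}/\mathbb{Z})^d\to X$ let $f^*(t)=\inf\{r\ge 0: |\{s:\|f(s)\|_X>r\}|\le t\}$ and $$\|f\|_{L^{p_0,q}(\mathbb{T}^d;X)}=\Big(\int_0^1\big(t^{1/p_0}f^*(t)\big)^q\,\frac{dt}{t}\Big)^{1/q},$$ with $L^{p_0,q}(\mathbb{T}^d;X)$ the space of those $f$ for which this is finite. For $x=(x_n)_{n\in\mathbb{Z}^d}\subset X$ and $k\ge 1$ let $x_k^*=\inf\{r\ge 0:\#\{n:\|x_n\|_X>r\}\le k-1\}$, and for $b\in\mathbb{R}$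 let $$\|x\|_{\ell^{p_0',q}(\log\ell)^b(\mathbb{Z}^d;X)}=\Big(\sum_{k=1}^\infty\big(k^{1/p_0'}(1+\log k)^b x_k^*\big)^q\,\frac1k\Big)^{1/q}.$$ For $q=\infty$ both expressions are replaced by suprema (over $0<t<1$ and $k\ge1$, without the factors $dt/t$ and $1/k$), and $1/\max\{p_0',q\}=0$. Then every $f\in L^{p_0,q}(\mathbb{T}^d;X)$ is integrable, and the map $\mathcal{F}:f\mapsto(\widehat f(n))_{n\in\mathbb{Z}^d}$, $\widehat f(n)=\int_{\mathbb{T}^d}f(t)e^{-2\pi i n\cdot t}\,dt$, is bounded $$\mathcal{F}: L^{p_0,q}(\mathbb{T}^d;X)\to \ell^{p_0',q}(\log\ell)^{-1/p_0+1/\max\{p_0',q\}}(\mathbb{Z}^d;X),$$ that is, there is a constant $C$ with $\|\mathcal{F}f\|_{\ell^{p_0',q}(\log\ell)^{-1/p_0+1/\max\{p_0',q\}}(\mathbb{Z}^d;X)}\le C\|f\|_{L^{p_0,q}(\mathbb{T}^d;X)}$ for all $f\in L^{p_0,q}(\mathbb{T}^d;X)$. In particular, there is a constant $C$ such that for all $f\in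 L^{p_0,q}(\mathbb{T}^d;X)$ and all integers $n\ge 1$, writing $\widehat f^*(n)$ for the $n$-th term of the non-increasing rearrangement of $(\widehat f(m))_{m\in\mathbb{Z}^d}$, $$\widehat f^*(n)\le C\,n^{-1/p_0'}(1+\log n)^{1/p_0-1/\max\{p_0',q\}}\,\|f\|_{L^{p_0,q}(\mathbb{T}^d;X)}.$$ -/

import Mathlib

open MeasureTheory
open scoped ENNReal NNReal FourierTransform

noncomputable section

/-- `X` has Fourier type `p` on `ℝ^d`: the Fourier transform
`f ↦ ∫ f(t) e^{-2πi⟨t,ξ⟩} dt` satisfies `‖𝓕 f‖_{L^{p'}(ℝ^d;X)} ≤ C ‖f‖_{L^p(ℝ^d;X)}` for all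
`X`-valued Schwartz functions `f`, where `p' = p / (p - 1)`. -/
def HasFourierType (X : Type*) [NormedAddCommGroup X] [NormedSpace ℂ X] (p : ℝ) (d : ℕ) : Prop :=
  ∃ C : ℝ≥0, ∀ f : SchwartzMap (EuclideanSpace ℝ (Fin d)) X,
    eLpNorm (𝓕 (f : EuclideanSpace ℝ (Fin d) → X)) (ENNReal.ofReal p.conjExponent) volume
      ≤ C * eLpNorm (f : EuclideanSpace ℝ (Fin d) → X) (ENNReal.ofReal p) volume

/-- The non-increasing rearrangement `f^*(t)`, `t ≥ 0`, of `s ↦ ‖f s‖` with respect to `μ`: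
the infimum of all `r ∈ [0,∞]` with `μ {s | ‖f s‖ > r} ≤ t`. -/
def rearrangement {S X : Type*} [MeasurableSpace S] [NormedAddCommGroup X]
    (μ : Measure S) (f : S → X) (t : ℝ) : ℝ≥0∞ :=
  sInf {r : ℝ≥0∞ | μ {s | r < ‖f s‖ₑ} ≤ ENNReal.ofReal t}

/-- The Lorentz–Zygmund functional of `L^{p,q}(log L)^b(S;X)`, for `1 ≤ p < ∞`, `1 ≤ q ≤ ∞`:
`(∫_0^{μ(S)} (t^{1/p} (1 + |log t|)^b f^*(t))^q dt/t)^{1/q}`, a supremum over `0 < t < μ(S)` if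
`q = ∞`. -/
def lorentzZygmundNorm {S X : Type*} [MeasurableSpace S] [NormedAddCommGroup X]
    (μ : Measure S) (p : ℝ) (q : ℝ≥0∞) (b : ℝ) (f : S → X) : ℝ≥0∞ :=
  if q = ∞ then
    ⨆ t ∈ {t : ℝ | 0 < t ∧ ENNReal.ofReal t < μ Set.univ},
      ENNReal.ofReal (t ^ (1 / p) * (1 + |Real.log t|) ^ b) * rearrangement μ f t
  else
    (∫⁻ t in {t : ℝ | 0 < t ∧ ENNReal.ofReal t < μ Set.univ},
      (ENNReal.ofReal (t ^ (1 / p) * (1 + |Real.log t|) ^ b) * rearrangement μ f t) ^ q.toReal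
        * ENNReal.ofReal (1 / t)) ^ (1 / q.toReal)

/-- The Lorentz functional of `L^{p,q}(S;X)`, the case `b = 0` of the above. -/
def lorentzNorm {S X : Type*} [MeasurableSpace S] [NormedAddCommGroup X]
    (μ : Measure S) (p : ℝ) (q : ℝ≥0∞) (f : S → X) : ℝ≥0∞ :=
  lorentzZygmundNorm μ p q 0 f

/-- Membership of `f` in `L^{p,q}(S;X)`. -/
def MemLorentz {S X : Type*} [MeasurableSpace S] [NormedAddCommGroup X]
    (μ : Measure S) (p : ℝ) (q : ℝ≥0∞) (f : S → X) : Prop :=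
  AEStronglyMeasurable f μ ∧ lorentzNorm μ p q f < ∞

/-- The non-increasing rearrangement `x_k^*`, `k = 1, 2, …`, of a family `(x_n)_{n ∈ ℤ^d}`:
`x_k^*` is the value on `[k-1, k)` of the rearrangement with respect to counting measure, i.e.
the infimum of all `r` such that `‖x_n‖ > r` for at most `k - 1` indices `n`. -/
def seqRearrangement {d : ℕ} {X : Type*} [NormedAddCommGroup X]
    (x : (Fin d → ℤ) → X) (k : ℕ) : ℝ≥0∞ :=
  rearrangement Measure.count x ((k : ℝ) - 1)

/-- The functional of `ℓ^{p,q}(log ℓ)^b(ℤ^d;X)`, for `1 ≤ p < ∞`, `1 ≤ q ≤ ∞`: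
`(∑_{k ≥ 1} (k^{1/p} (1 + log k)^b x_k^*)^q / k)^{1/q}`, a supremum over `k ≥ 1` if `q = ∞`.
Below `k` runs over `ℕ+`. -/
def seqLorentzZygmundNorm {d : ℕ} {X : Type*} [NormedAddCommGroup X]
    (p : ℝ) (q : ℝ≥0∞) (b : ℝ) (x : (Fin d → ℤ) → X) : ℝ≥0∞ :=
  if q = ∞ then
    ⨆ k : ℕ+, ENNReal.ofReal ((k : ℝ) ^ (1 / p) * (1 + Real.log k) ^ b) * seqRearrangement x k
  else
    (∑' k : ℕ+,
      (ENNReal.ofReal ((k : ℝ) ^ (1 / p) * (1 + Real.log k) ^ b) * seqRearrangement x k) ^ q.toReal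
        * ENNReal.ofReal (1 / (k : ℝ))) ^ (1 / q.toReal)

/-- The normalized Lebesgue (Haar) measure on the torus `𝕋^d = (ℝ/ℤ)^d`. -/
def torusMeasure (d : ℕ) : Measure (UnitAddTorus (Fin d)) :=
  Measure.pi fun _ => (AddCircle.haarAddCircle : Measure UnitAddCircle)

/-- Mathlib's Fourier coefficients on the torus are
`f̂(n) = ∫_{𝕋^d} f(t) e^{-2πi n·t} dt` for the measure `torusMeasure d`. -/
theorem mFourierCoeff_eq_torusMeasure {X : Type*} [NormedAddCommGroup X] [NormedSpace ℂ X]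
    {d : ℕ} (f : UnitAddTorus (Fin d) → X) (n : Fin d → ℤ) :
    UnitAddTorus.mFourierCoeff f n
      = ∫ t, UnitAddTorus.mFourier (-n) t • f t ∂(torusMeasure d) := rfl

end

/-! Write `p` for `p₀`, `p'` for its conjugate exponent, `x_j^*` for the rearranged Fourier
coefficients and `L_k = 1 + log k`.

Fourier type on `ℝ^d` transfers to the torus. A sum of bumps centred at lattice points, with
coefficients `c n`, has as inverse transform a fixed Schwartz function times the trigonometric
polynomial with these coefficients. Testing Fourier type on this product, together with density of
trigonometric polynomials, gives the Hausdorff-Young bound `L^p → ℓ^{p'}`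
(`HasFourierType.hausdorffYoung_torus`).

Cutting `f` at height `f^*(1/k)` and using `L^1 → ℓ^∞` on the large part and Hausdorff-Young on the
small part bounds `G_k^{1/p'}`, where `G_k = ∑_{j ≤ k} (x_j^*)^{p'}`, by a multiple of `k^{1/p'}
∫_0^{1/k} f^* + (∫_{1/k}^1 (f^*)^p)^{1/p}` (`HasFourierType.sum_seqRearrangement_le`).

For `q = ∞`, inserting `f^*(t) ≤ N t^{-1/p}` makes the first term bounded and the second of order
`L_k^{1/p}`.

For `q < ∞`, the estimate is raised to the power `q` and summed against `k⁻¹ L_k^{-q/p}`. The first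
term is handled by a Hardy inequality with power weights, the second by its logarithmic endpoint
version, which needs `q/p > 1`. This controls `∑ k⁻¹ L_k^{-q/p} G_k^{q/p'}`
(`HasFourierType.tsum_partial_sums_le`). The crude bound `k (x_k^*)^{p'} ≤ G_k` would give only the
logarithmic exponent `-1/p`. Summation by parts exploits that the `x_k^*` are increments of `G` and
gains `L_k^{min(q/p', 1)}` (`tsum_antitone_le_tsum_partial_sums`); after the `q`-th root this is the
term `1/max(p', q)`.

The pointwise decay follows by keeping the first `n` terms of the norm, since both the sequence and
the logarithmic weight are non-increasing. -/

/-! ### Periodization of Schwartz functions and lattice characters. -/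

theorem summable_one_div_one_add_abs_sq :
    Summable fun n : ℤ => 1 / (1 + |(n : ℝ)|) ^ 2 := by
  have h : Summable fun n : ℕ => 1 / (1 + (n : ℝ)) ^ 2 := by
    have := (summable_nat_add_iff 1).2 (Real.summable_one_div_nat_pow.2 one_lt_two)
    refine this.congr fun n => ?_
    push_cast
    rw [add_comm (1 : ℝ)]
  refine Summable.of_nat_of_neg ?_ ?_
  · simpa using h
  · simpa using h

/-- A product of summable weights is summable over `ℤ^d`. -/
theorem tsum_pi_prod_le {d : ℕ} (v : ℤ → ℝ≥0∞) :
    ∑' k : Fin d → ℤ, ∏ i, v (k i) ≤ (∑' n, v n) ^ d := by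
  classical
  rw [ENNReal.tsum_eq_iSup_sum]
  refine iSup_le fun s => ?_
  let t : Finset ℤ := s.biUnion fun k => Finset.univ.image k
  have hs : s ⊆ Fintype.piFinset fun _ : Fin d => t := by
    intro k hk
    rw [Fintype.mem_piFinset]
    intro i
    exact Finset.mem_biUnion.2 ⟨k, hk, Finset.mem_image_of_mem _ (Finset.mem_univ i)⟩
  calc ∑ k ∈ s, ∏ i, v (k i)
      ≤ ∑ k ∈ Fintype.piFinset fun _ : Fin d => t, ∏ i, v (k i) :=
        Finset.sum_le_sum_of_subset hs
    _ = ∏ _i : Fin d, ∑ n ∈ t, v n := (Finset.prod_univ_sum _ _).symm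
    _ = (∑ n ∈ t, v n) ^ d := by simp
    _ ≤ _ := by gcongr; exact ENNReal.sum_le_tsum t

theorem lintegral_torus_eq {d : ℕ} (F : UnitAddTorus (Fin d) → ℝ≥0∞) (a : Fin d → ℝ) :
    ∫⁻ t, F t ∂torusMeasure d =
      ∫⁻ x : Fin d → ℝ in {x | ∀ i, x i ∈ Set.Ioc (a i) (a i + 1)}, F fun i => x i :=
  UnitAddTorus.lintegral_preimage F a

/-- Decay of order `2 * d` supplies a factor `(1 + ‖y‖) ^ 2` for each coordinate, and `1 + |k i| ≤ 2
* (1 + ‖y‖)` on the cube. The product form lets the sum over all cubes factor into one-dimensional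
sums. -/
theorem norm_schwartz_le_of_mem_cube {d : ℕ} (ψ : SchwartzMap (EuclideanSpace ℝ (Fin d)) ℂ) :
    ∃ M : ℝ≥0, ∀ (k : Fin d → ℤ) (x : Fin d → ℝ),
      (∀ i, x i ∈ Set.Ioc (k i : ℝ) (k i + 1)) →
      ‖ψ (WithLp.toLp 2 x)‖ₑ ≤ M * ∏ i, ENNReal.ofReal (1 / (1 + |(k i : ℝ)|) ^ 2) := by
  set B := 2 ^ (2 * d) *
    ((Finset.Iic (2 * d, 0)).sup fun m => SchwartzMap.seminorm ℂ m.1 m.2) ψ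
  have hB : 0 ≤ B := by positivity
  refine ⟨Real.toNNReal (4 ^ d * B), fun k x hx => ?_⟩
  have h1 := SchwartzMap.one_add_le_sup_seminorm_apply (𝕜 := ℂ) (m := (2 * d, 0))
    (k := 2 * d) (n := 0) le_rfl le_rfl ψ (WithLp.toLp 2 x)
  rw [norm_iteratedFDeriv_zero] at h1
  set y : EuclideanSpace ℝ (Fin d) := WithLp.toLp 2 x with hy
  have h2 : ∏ i, (1 + |(k i : ℝ)|) ^ 2 ≤ (4 : ℝ) ^ d * (1 + ‖y‖) ^ (2 * d) := by
    calc ∏ i, (1 + |(k i : ℝ)|) ^ 2 ≤ ∏ _i : Fin d, 4 * (1 + ‖y‖) ^ 2 := by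
          refine Finset.prod_le_prod (fun i _ => by positivity) fun i _ => ?_
          have h3 : |x i| ≤ ‖y‖ := by simpa [hy] using PiLp.norm_apply_le y i
          have h4 : |(k i : ℝ)| ≤ |x i| + 1 := by
            have := hx i
            rw [Set.mem_Ioc] at this
            rw [abs_le]
            constructor <;> cases abs_cases (x i) <;> linarith
          have : 1 + |(k i : ℝ)| ≤ 2 * (1 + ‖y‖) := by linarith [norm_nonneg y]
          calc (1 + |(k i : ℝ)|) ^ 2 ≤ (2 * (1 + ‖y‖)) ^ 2 := by gcongr
            _ = _ := by ring
      _ = _ := by simp [mul_pow, pow_mul]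
  have h5 : ‖ψ y‖ ≤ 4 ^ d * B * ∏ i, (1 / (1 + |(k i : ℝ)|) ^ 2) := by
    rw [Finset.prod_div_distrib, Finset.prod_const_one, mul_one_div,
      le_div_iff₀ (Finset.prod_pos fun i _ => by positivity)]
    calc ‖ψ y‖ * ∏ i, (1 + |(k i : ℝ)|) ^ 2
        ≤ ‖ψ y‖ * (4 ^ d * (1 + ‖y‖) ^ (2 * d)) := by gcongr
      _ = 4 ^ d * ((1 + ‖y‖) ^ (2 * d) * ‖ψ y‖) := by ring
      _ ≤ _ := by gcongr
  rw [← ofReal_norm]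
  refine (ENNReal.ofReal_le_ofReal h5).trans ?_
  rw [ENNReal.ofReal_mul (by positivity), ENNReal.ofReal_prod_of_nonneg (fun i _ => by positivity)]
  rfl

/-- Integrals against a power of a Schwartz function are controlled by periodization. -/
theorem lintegral_schwartz_mul_periodic_le {d : ℕ}
    (ψ : SchwartzMap (EuclideanSpace ℝ (Fin d)) ℂ) {p : ℝ} (hp : 1 ≤ p) :
    ∃ C : ℝ≥0, ∀ F : UnitAddTorus (Fin d) → ℝ≥0∞,
      ∫⁻ x : EuclideanSpace ℝ (Fin d), ‖ψ x‖ₑ ^ p * F (fun i => (x i : UnitAddCircle))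
        ≤ C * ∫⁻ t, F t ∂torusMeasure d := by
  obtain ⟨M, hM⟩ := norm_schwartz_le_of_mem_cube ψ
  set v : ℤ → ℝ≥0∞ := fun n => ENNReal.ofReal (1 / (1 + |(n : ℝ)|) ^ 2) with hv
  have hv1 : ∀ n, v n ≤ 1 := by
    intro n
    rw [hv, ENNReal.ofReal_le_one, div_le_one (by positivity)]
    exact one_le_pow₀ (by linarith [abs_nonneg (n : ℝ)])
  have hvs : ∑' n, v n ≠ ∞ := summable_one_div_one_add_abs_sq.tsum_ofReal_ne_top
  have hC : (M : ℝ≥0∞) ^ p * (∑' n, v n) ^ d ≠ ∞ :=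
    ENNReal.mul_ne_top (ENNReal.rpow_ne_top_of_nonneg (by linarith) ENNReal.coe_ne_top)
      (ENNReal.pow_ne_top hvs)
  refine ⟨((M : ℝ≥0∞) ^ p * (∑' n, v n) ^ d).toNNReal, fun F => ?_⟩
  rw [ENNReal.coe_toNNReal hC]
  rw [← (PiLp.volume_preserving_toLp (Fin d)).lintegral_comp_emb
    (MeasurableEquiv.toLp 2 (Fin d → ℝ)).measurableEmbedding]
  set cube : (Fin d → ℤ) → Set (Fin d → ℝ) :=
    fun k => {x | ∀ i, x i ∈ Set.Ioc (k i : ℝ) (k i + 1)} with hcube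
  have hcm : ∀ k, MeasurableSet (cube k) := fun k =>
    MeasurableSet.univ_pi' fun i => measurableSet_Ioc
  -- The cubes are open on the left and closed on the right, hence the index `⌈x i⌉ - 1` instead of
  -- the floor.
  have hcov : (⋃ k, cube k) = Set.univ := by
    refine Set.eq_univ_of_forall fun x => Set.mem_iUnion.2 ⟨fun i => ⌈x i⌉ - 1, fun i => ?_⟩
    push_cast
    exact ⟨by linarith [Int.ceil_lt_add_one (x i)], by linarith [Int.le_ceil (x i)]⟩
  rw [← setLIntegral_univ, ← hcov]
  refine (lintegral_iUnion_le _ _).trans ?_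
  calc ∑' k, ∫⁻ x in cube k, ‖ψ (WithLp.toLp 2 x)‖ₑ ^ p * F (fun i => (x i : UnitAddCircle))
      ≤ ∑' k : Fin d → ℤ, ((M : ℝ≥0∞) ^ p * ∏ i, v (k i)) * ∫⁻ t, F t ∂torusMeasure d := by
        refine ENNReal.tsum_le_tsum fun k => ?_
        have hfin : (M : ℝ≥0∞) ^ p * ∏ i, v (k i) ≠ ∞ :=
          ENNReal.mul_ne_top (ENNReal.rpow_ne_top_of_nonneg (by linarith) ENNReal.coe_ne_top)
            (ENNReal.prod_ne_top fun i _ => ENNReal.ofReal_ne_top)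
        rw [lintegral_torus_eq F fun i => k i, ← lintegral_const_mul' _ _ hfin]
        refine setLIntegral_mono' (hcm k) fun x hx => ?_
        gcongr
        -- The weights are at most one, so the power `p ≥ 1` on them can be dropped.
        have hle : ∏ i, v (k i) ≤ 1 := Finset.prod_le_one' fun i _ => hv1 _
        calc ‖ψ (WithLp.toLp 2 x)‖ₑ ^ p ≤ (M * ∏ i, v (k i)) ^ p := by
              gcongr; exact hM k x hx
          _ = (M : ℝ≥0∞) ^ p * (∏ i, v (k i)) ^ p :=
              ENNReal.mul_rpow_of_nonneg _ _ (by linarith)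
          _ ≤ _ := by
              gcongr
              exact (ENNReal.rpow_le_rpow_of_exponent_ge hle hp).trans_eq (ENNReal.rpow_one _)
    _ = (M : ℝ≥0∞) ^ p * (∑' k : Fin d → ℤ, ∏ i, v (k i)) * ∫⁻ t, F t ∂torusMeasure d := by
        rw [ENNReal.tsum_mul_right, ENNReal.tsum_mul_left]
    _ ≤ _ := by gcongr; exact tsum_pi_prod_le v

instance (d : ℕ) : IsProbabilityMeasure (torusMeasure d) := by
  unfold torusMeasure; infer_instance

/-- The point of `ℝ^d` with integer coordinates `n`. -/
noncomputable def latticePoint {d : ℕ} (n : Fin d → ℤ) : EuclideanSpace ℝ (Fin d) :=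
  WithLp.toLp 2 fun i => (n i : ℝ)

theorem one_le_dist_latticePoint {d : ℕ} {n m : Fin d → ℤ} (h : n ≠ m) :
    1 ≤ dist (latticePoint n) (latticePoint m) := by
  obtain ⟨i, hi⟩ := Function.ne_iff.1 h
  rw [dist_eq_norm]
  refine le_trans ?_ (PiLp.norm_apply_le (latticePoint n - latticePoint m) i)
  have h1 : (1 : ℤ) ≤ |n i - m i| := Int.one_le_abs (sub_ne_zero.2 hi)
  simp only [latticePoint, PiLp.sub_apply, Real.norm_eq_abs]
  exact_mod_cast h1

theorem mFourier_eq_fourierChar {d : ℕ} (n : Fin d → ℤ) (x : EuclideanSpace ℝ (Fin d)) :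
    UnitAddTorus.mFourier n (fun i => (x i : UnitAddCircle)) =
      (Real.fourierChar (inner ℝ (latticePoint n) x) : ℂ) := by
  simp only [UnitAddTorus.mFourier, ContinuousMap.coe_mk, fourier_coe_apply]
  rw [← Complex.exp_sum, Real.fourierChar_apply]
  congr 1
  simp only [latticePoint, PiLp.inner_apply, RCLike.inner_apply, conj_trivial]
  push_cast
  rw [Finset.mul_sum, Finset.sum_mul]
  refine Finset.sum_congr rfl fun i _ => ?_
  simp
  ring

/-! ### Transference from `ℝ^d` to the torus. -/

section Transference

variable {X : Type*} [NormedAddCommGroup X] [NormedSpace ℂ X]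

/-- The `X`-valued trigonometric polynomial with coefficients `c`. -/
noncomputable def trigPoly {d : ℕ} (c : (Fin d → ℤ) →₀ X) (t : UnitAddTorus (Fin d)) : X :=
  c.sum fun n x => UnitAddTorus.mFourier n t • x

theorem continuous_trigPoly {d : ℕ} (c : (Fin d → ℤ) →₀ X) : Continuous (trigPoly c) := by
  unfold trigPoly Finsupp.sum
  fun_prop

/-- A smooth bump function on `ℝ^d` supported in the ball of radius `1/2`. -/
noncomputable def latticeBump (d : ℕ) : ContDiffBump (0 : EuclideanSpace ℝ (Fin d)) :=
  ⟨1 / 4, 1 / 2, by norm_num, by norm_num⟩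

/-- Lattice points are at mutual distance at least one, so a point within `1/4` of one of them is at
least `3/4` away from every other, outside the support radius `1/2`. -/
theorem latticeBump_eq_zero {d : ℕ} {n m : Fin d → ℤ} (h : n ≠ m)
    {ξ : EuclideanSpace ℝ (Fin d)} (hξ : ξ ∈ Metric.ball (latticePoint n) (1 / 4)) :
    latticeBump d (ξ - latticePoint m) = 0 := by
  refine (latticeBump d).zero_of_le_dist ?_
  rw [dist_zero_right, ← dist_eq_norm]
  have h1 := one_le_dist_latticePoint h
  have h2 := dist_triangle_left (latticePoint n) (latticePoint m) ξ
  have h3 : dist ξ (latticePoint n) < 1 / 4 := hξ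
  change (1 / 2 : ℝ) ≤ _
  linarith

theorem latticeBump_eq_one {d : ℕ} {n : Fin d → ℤ}
    {ξ : EuclideanSpace ℝ (Fin d)} (hξ : ξ ∈ Metric.ball (latticePoint n) (1 / 4)) :
    latticeBump d (ξ - latticePoint n) = 1 := by
  refine (latticeBump d).one_of_mem_closedBall ?_
  rw [mem_closedBall_zero_iff, ← dist_eq_norm]
  exact (Metric.mem_ball.1 hξ).le

theorem hasCompactSupport_latticeBump (d : ℕ) :
    HasCompactSupport fun ξ => (latticeBump d ξ : ℂ) :=
  (latticeBump d).hasCompactSupport.comp_left (g := fun r : ℝ => (r : ℂ)) Complex.ofReal_zero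

theorem contDiff_latticeBump (d : ℕ) : ContDiff ℝ (⊤ : ℕ∞) fun ξ => (latticeBump d ξ : ℂ) :=
  Complex.ofRealCLM.contDiff.comp (latticeBump d).contDiff

theorem hasCompactSupport_finset_sum {E F ι : Type*} [TopologicalSpace E] [AddCommMonoid F]
    (s : Finset ι) (f : ι → E → F) (h : ∀ i ∈ s, HasCompactSupport (f i)) :
    HasCompactSupport fun x => ∑ i ∈ s, f i x := by
  classical
  induction s using Finset.induction_on with
  | empty => simp only [Finset.sum_empty]; exact HasCompactSupport.zero
  | insert a s ha ih =>
    simp only [Finset.sum_insert ha]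
    exact (h a (Finset.mem_insert_self a s)).add
      (ih fun i hi => h i (Finset.mem_insert_of_mem hi))

/-- The sum of the translates of the bump function to lattice points, with coefficients `c`. -/
noncomputable def bumpSum {d : ℕ} (c : (Fin d → ℤ) →₀ X) :
    SchwartzMap (EuclideanSpace ℝ (Fin d)) X :=
  HasCompactSupport.toSchwartzMap
    (f := fun ξ => ∑ n ∈ c.support, (latticeBump d (ξ - latticePoint n) : ℂ) • c n)
    (hasCompactSupport_finset_sum _ _ fun n _ => HasCompactSupport.smul_right
      ((hasCompactSupport_latticeBump d).comp_homeomorph (Homeomorph.subRight (latticePoint n))))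
    (ContDiff.sum fun _ _ => ContDiff.smul
      ((contDiff_latticeBump d).comp (contDiff_id.sub contDiff_const)) contDiff_const)

theorem bumpSum_apply {d : ℕ} (c : (Fin d → ℤ) →₀ X) (ξ : EuclideanSpace ℝ (Fin d)) :
    bumpSum c ξ = ∑ n ∈ c.support, (latticeBump d (ξ - latticePoint n) : ℂ) • c n := rfl

/-- The bump function as a Schwartz function. -/
noncomputable def schwartzBump (d : ℕ) : SchwartzMap (EuclideanSpace ℝ (Fin d)) ℂ :=
  (hasCompactSupport_latticeBump d).toSchwartzMap (contDiff_latticeBump d)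

/-- On the disjoint balls of radius `1/4` about the lattice points the bump sum is constant, equal
to the corresponding coefficient. -/
theorem sum_enorm_rpow_le_lintegral_bumpSum {d : ℕ} (c : (Fin d → ℤ) →₀ X) (r : ℝ) :
    volume (Metric.ball (0 : EuclideanSpace ℝ (Fin d)) (1 / 4)) * ∑ n ∈ c.support, ‖c n‖ₑ ^ r
      ≤ ∫⁻ ξ, ‖bumpSum c ξ‖ₑ ^ r := by
  have hdisj : Set.PairwiseDisjoint (↑c.support)
      fun n : Fin d → ℤ => Metric.ball (latticePoint n) (1 / 4) := by
    intro n _ m _ hnm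
    refine Metric.ball_disjoint_ball ?_
    linarith [one_le_dist_latticePoint hnm]
  calc volume (Metric.ball (0 : EuclideanSpace ℝ (Fin d)) (1 / 4)) * ∑ n ∈ c.support, ‖c n‖ₑ ^ r
      = ∑ n ∈ c.support, ∫⁻ _ in Metric.ball (latticePoint n) (1 / 4), ‖c n‖ₑ ^ r := by
        rw [Finset.mul_sum]
        refine Finset.sum_congr rfl fun n _ => ?_
        rw [setLIntegral_const, Measure.addHaar_ball_center volume (latticePoint n), mul_comm]
    _ = ∑ n ∈ c.support, ∫⁻ ξ in Metric.ball (latticePoint n) (1 / 4), ‖bumpSum c ξ‖ₑ ^ r := by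
        refine Finset.sum_congr rfl fun n hn => ?_
        refine setLIntegral_congr_fun Metric.isOpen_ball.measurableSet fun ξ hξ => ?_
        simp only [bumpSum_apply]
        rw [Finset.sum_eq_single n, latticeBump_eq_one hξ]
        · simp
        · intro m _ hm
          rw [latticeBump_eq_zero hm.symm hξ]
          simp
        · exact fun h => absurd hn h
    _ = ∫⁻ ξ in ⋃ n ∈ c.support, Metric.ball (latticePoint n) (1 / 4), ‖bumpSum c ξ‖ₑ ^ r :=
        (lintegral_biUnion_finset hdisj
          (fun n _ => Metric.isOpen_ball.measurableSet) _).symm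
    _ ≤ _ := setLIntegral_le_lintegral _ _

/-- The inverse transform turns translation by a lattice point into multiplication by a character
that is periodic, so the transform of a single bump factors out. -/
theorem fourierInv_bumpSum [CompleteSpace X] {d : ℕ} (c : (Fin d → ℤ) →₀ X)
    (x : EuclideanSpace ℝ (Fin d)) :
    𝓕⁻ (bumpSum c : EuclideanSpace ℝ (Fin d) → X) x =
      𝓕⁻ (schwartzBump d : EuclideanSpace ℝ (Fin d) → ℂ) x •
        trigPoly c (fun i => (x i : UnitAddCircle)) := by
  have hint : ∀ n : Fin d → ℤ, ∀ y : X, ∫ v, Real.fourierChar (inner ℝ v x) •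
      (latticeBump d (v - latticePoint n) : ℂ) • y =
      (∫ v, Real.fourierChar (inner ℝ v x) • (schwartzBump d v)) •
        UnitAddTorus.mFourier n (fun i => (x i : UnitAddCircle)) • y := by
    intro n y
    rw [← integral_add_right_eq_self _ (latticePoint n), ← integral_smul_const]
    refine integral_congr_ae (Filter.Eventually.of_forall fun v => ?_)
    simp only [add_sub_cancel_right, inner_add_left, AddChar.map_add_eq_mul, Circle.smul_def,
      Circle.coe_mul, mFourier_eq_fourierChar, smul_smul, smul_eq_mul]
    congr 1
    change _ = _ * (latticeBump d v : ℂ) * _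
    ring
  rw [Real.fourierInv_eq, Real.fourierInv_eq]
  simp only [bumpSum_apply, Finset.smul_sum, trigPoly, Finsupp.sum]
  rw [integral_finsetSum]
  · exact Finset.sum_congr rfl fun n _ => hint n (c n)
  · intro n _
    have h1 : Integrable fun v : EuclideanSpace ℝ (Fin d) =>
        (latticeBump d (v - latticePoint n) : ℂ) • c n :=
      (((schwartzBump d).integrable (μ := volume)).comp_sub_right (latticePoint n)).smul_const _
    have := (Real.fourierIntegral_convergent_iff (-x)).2 h1
    simpa using this

/-- Transference: Fourier type on `ℝ^d` yields the Hausdorff-Young inequality for trigonometric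
polynomials on the torus. -/
theorem HasFourierType.trigPoly_le [CompleteSpace X] {d : ℕ} {p : ℝ} (hp : 1 < p)
    (hX : HasFourierType X p d) :
    ∃ K : ℝ≥0, ∀ c : (Fin d → ℤ) →₀ X,
      (∑ n ∈ c.support, ‖c n‖ₑ ^ p.conjExponent) ^ (1 / p.conjExponent)
        ≤ K * eLpNorm (trigPoly c) (ENNReal.ofReal p) (torusMeasure d) := by
  obtain ⟨C, hC⟩ := hX
  have hp' : 1 < p.conjExponent := (Real.HolderConjugate.conjExponent hp).symm.lt
  set p' := p.conjExponent
  obtain ⟨A, hA⟩ := lintegral_schwartz_mul_periodic_le (𝓕⁻ (schwartzBump d)) hp.le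
  set V := volume (Metric.ball (0 : EuclideanSpace ℝ (Fin d)) (1 / 4)) with hV
  have hV0 : V ≠ 0 := (Metric.measure_ball_pos volume _ (by norm_num)).ne'
  have hVt : V ≠ ∞ := measure_ball_lt_top.ne
  have hKt : (V⁻¹) ^ (1 / p') * (C * (A : ℝ≥0∞) ^ (1 / p)) ≠ ∞ := by
    refine ENNReal.mul_ne_top (ENNReal.rpow_ne_top_of_nonneg (by positivity)
      (ENNReal.inv_ne_top.2 hV0)) (ENNReal.mul_ne_top ENNReal.coe_ne_top
      (ENNReal.rpow_ne_top_of_nonneg (by positivity) ENNReal.coe_ne_top))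
  refine ⟨((V⁻¹) ^ (1 / p') * (C * (A : ℝ≥0∞) ^ (1 / p))).toNNReal, fun c => ?_⟩
  rw [ENNReal.coe_toNNReal hKt]
  -- The transform of this test function is the bump sum, whose `L^{p'}` norm dominates the `ℓ^{p'}`
  -- norm of `c`; the function itself is a Schwartz function times a periodic one, whose `L^p` norm
  -- is controlled by periodization.
  have h1 := hC (𝓕⁻ (bumpSum c))
  have h2 : 𝓕 ((𝓕⁻ (bumpSum c) : SchwartzMap _ X) : EuclideanSpace ℝ (Fin d) → X)
      = bumpSum c := by
    rw [← SchwartzMap.fourier_coe, FourierTransform.fourier_fourierInv_eq]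
  rw [h2, eLpNorm_eq_lintegral_rpow_enorm_toReal (by simp; linarith) ENNReal.ofReal_ne_top,
    eLpNorm_eq_lintegral_rpow_enorm_toReal (by simp; linarith) ENNReal.ofReal_ne_top,
    ENNReal.toReal_ofReal (by linarith), ENNReal.toReal_ofReal (by linarith)] at h1
  rw [eLpNorm_eq_lintegral_rpow_enorm_toReal (by simp; linarith) ENNReal.ofReal_ne_top,
    ENNReal.toReal_ofReal (by linarith)]
  have h3 : ∫⁻ x, ‖(𝓕⁻ (bumpSum c) : SchwartzMap _ X) x‖ₑ ^ p ≤
      A * ∫⁻ t, ‖trigPoly c t‖ₑ ^ p ∂torusMeasure d := by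
    refine le_trans (le_of_eq ?_) (hA fun t => ‖trigPoly c t‖ₑ ^ p)
    refine lintegral_congr fun x => ?_
    rw [SchwartzMap.fourierInv_coe, SchwartzMap.fourierInv_coe, fourierInv_bumpSum, enorm_smul,
      ENNReal.mul_rpow_of_nonneg _ _ (by linarith)]
  have h4 : ∑ n ∈ c.support, ‖c n‖ₑ ^ p' ≤ V⁻¹ * ∫⁻ ξ, ‖bumpSum c ξ‖ₑ ^ p' := by
    rw [← ENNReal.mul_le_iff_le_inv hV0 hVt]
    exact sum_enorm_rpow_le_lintegral_bumpSum c p'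
  calc (∑ n ∈ c.support, ‖c n‖ₑ ^ p') ^ (1 / p')
      ≤ (V⁻¹ * ∫⁻ ξ, ‖bumpSum c ξ‖ₑ ^ p') ^ (1 / p') := by gcongr
    _ = (V⁻¹) ^ (1 / p') * (∫⁻ ξ, ‖bumpSum c ξ‖ₑ ^ p') ^ (1 / p') :=
        ENNReal.mul_rpow_of_nonneg _ _ (by positivity)
    _ ≤ (V⁻¹) ^ (1 / p') *
        (C * (A * ∫⁻ t, ‖trigPoly c t‖ₑ ^ p ∂torusMeasure d) ^ (1 / p)) := by
        gcongr
        refine h1.trans ?_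
        gcongr
    _ = _ := by
        rw [ENNReal.mul_rpow_of_nonneg _ _ (by positivity)]
        ring

end Transference

/-! ### Density of trigonometric polynomials and Hausdorff-Young on the torus. -/

section TrigonometricApproximation

variable {X : Type*} [NormedAddCommGroup X] [NormedSpace ℂ X]

theorem trigPoly_add {d : ℕ} (c c' : (Fin d → ℤ) →₀ X) :
    trigPoly (c + c') = trigPoly c + trigPoly c' := by
  funext t
  exact Finsupp.sum_add_index' (by simp) (by simp [smul_add])

theorem integral_mFourier_mul {d : ℕ} (m n : Fin d → ℤ) :
    ∫ t, UnitAddTorus.mFourier (-m) t * UnitAddTorus.mFourier n t ∂torusMeasure d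
      = if m = n then 1 else 0 := by
  classical
  have h := orthonormal_iff_ite.mp (UnitAddTorus.orthonormal_mFourier (d := Fin d)) m n
  rw [ContinuousMap.inner_toLp] at h
  convert h using 1
  refine integral_congr_ae (Filter.Eventually.of_forall fun t => ?_)
  simp only [UnitAddTorus.mFourier_neg]
  exact mul_comm _ _

theorem mFourierCoeff_trigPoly [CompleteSpace X] {d : ℕ} (c : (Fin d → ℤ) →₀ X)
    (m : Fin d → ℤ) : UnitAddTorus.mFourierCoeff (trigPoly c) m = c m := by
  rw [mFourierCoeff_eq_torusMeasure]
  simp only [trigPoly, Finsupp.sum, Finset.smul_sum, smul_smul]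
  rw [integral_finsetSum]
  · simp only [integral_smul_const, integral_mFourier_mul]
    simp only [ite_smul, one_smul, zero_smul, Finset.sum_ite_eq, Finsupp.mem_support_iff]
    by_cases h : c m = 0 <;> simp [h]
  · intro n _
    refine Integrable.smul_const ?_ _
    exact (ContinuousMap.continuous
      (UnitAddTorus.mFourier (-m) * UnitAddTorus.mFourier n)).integrable_of_hasCompactSupport
      (HasCompactSupport.of_compactSpace _)

theorem norm_mFourier_apply {d : ℕ} (n : Fin d → ℤ) (t : UnitAddTorus (Fin d)) :
    ‖UnitAddTorus.mFourier n t‖ = 1 := by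
  simp only [UnitAddTorus.mFourier, fourier_apply, ContinuousMap.coe_mk, norm_prod,
    Circle.norm_coe, Finset.prod_const_one]

theorem enorm_mFourier {d : ℕ} (n : Fin d → ℤ) (t : UnitAddTorus (Fin d)) :
    ‖UnitAddTorus.mFourier n t‖ₑ = 1 := by
  rw [← ofReal_norm, norm_mFourier_apply, ENNReal.ofReal_one]

theorem enorm_mFourierCoeff_le {d : ℕ} (f : UnitAddTorus (Fin d) → X) (n : Fin d → ℤ) :
    ‖UnitAddTorus.mFourierCoeff f n‖ₑ ≤ ∫⁻ t, ‖f t‖ₑ ∂torusMeasure d := by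
  rw [mFourierCoeff_eq_torusMeasure]
  refine (enorm_integral_le_lintegral_enorm _).trans (le_of_eq ?_)
  refine lintegral_congr fun t => ?_
  rw [enorm_smul, enorm_mFourier, one_mul]

theorem integrable_mFourier_smul {d : ℕ} {f : UnitAddTorus (Fin d) → X}
    (hf : Integrable f (torusMeasure d)) (n : Fin d → ℤ) :
    Integrable (fun t => UnitAddTorus.mFourier n t • f t) (torusMeasure d) := by
  refine hf.bdd_smul 1 (UnitAddTorus.mFourier n).continuous.aestronglyMeasurable ?_
  exact Filter.Eventually.of_forall fun t => (norm_mFourier_apply n t).le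

theorem mFourierCoeff_add {d : ℕ} {f g : UnitAddTorus (Fin d) → X}
    (hf : Integrable f (torusMeasure d)) (hg : Integrable g (torusMeasure d)) (n : Fin d → ℤ) :
    UnitAddTorus.mFourierCoeff (f + g) n =
      UnitAddTorus.mFourierCoeff f n + UnitAddTorus.mFourierCoeff g n := by
  simp only [mFourierCoeff_eq_torusMeasure, Pi.add_apply, smul_add]
  exact integral_add (integrable_mFourier_smul hf _) (integrable_mFourier_smul hg _)

theorem span_mFourier_dense_Lp (d : ℕ) {p : ℝ≥0∞} [Fact (1 ≤ p)] (hp : p ≠ ∞) :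
    (Submodule.span ℂ (Set.range fun n : Fin d → ℤ =>
      ContinuousMap.toLp (E := ℂ) p (torusMeasure d) ℂ
        (UnitAddTorus.mFourier n))).topologicalClosure = ⊤ :=
  UnitAddTorus.span_mFourierLp_closure_eq_top hp

/-- Trigonometric polynomials are dense in `L^p`. -/
theorem exists_trigPoly_eLpNorm_sub_le {d : ℕ} {p : ℝ≥0∞} [Fact (1 ≤ p)] (hp : p ≠ ∞)
    {f : UnitAddTorus (Fin d) → X} (hf : MemLp f p (torusMeasure d)) {ε : ℝ≥0∞} (hε : ε ≠ 0) :
    ∃ c : (Fin d → ℤ) →₀ X, eLpNorm (f - trigPoly c) p (torusMeasure d) ≤ ε := by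
  suffices h : ∃ g, eLpNorm (f - g) p (torusMeasure d) ≤ ε ∧ ∃ c, g = trigPoly c by
    obtain ⟨g, hg, c, rfl⟩ := h
    exact ⟨c, hg⟩
  refine hf.induction_dense hp (fun g => ∃ c, g = trigPoly c) ?_ ?_ ?_ hε
  · intro x s hs _ ε hε
    obtain ⟨δ, hδ0, hδ⟩ : ∃ δ : ℝ≥0, 0 < δ ∧ ‖x‖ₑ * δ ≤ ε := by
      have : Filter.Tendsto (fun δ : ℝ≥0 => ‖x‖ₑ * (δ : ℝ≥0∞)) (nhds 0) (nhds (‖x‖ₑ * (0 : ℝ≥0))) :=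
        ENNReal.Tendsto.const_mul (ENNReal.tendsto_coe.2 Filter.tendsto_id) (Or.inr enorm_ne_top)
      rw [ENNReal.coe_zero, mul_zero] at this
      have h1 := this.eventually (eventually_le_nhds (pos_iff_ne_zero.2 hε))
      have h2 := (h1.filter_mono nhdsWithin_le_nhds).and
        (self_mem_nhdsWithin (a := (0 : ℝ≥0)) (s := Set.Ioi 0))
      obtain ⟨δ, h3, h4⟩ := h2.exists
      exact ⟨δ, h4, h3⟩
    -- The vector-valued indicator is reduced to scalar density: the scalar indicator is
    -- approximated within `δ` and the approximant is multiplied by `x`.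
    have hmem : MemLp (s.indicator fun _ => (1 : ℂ)) p (torusMeasure d) :=
      memLp_indicator_const p hs 1 (Or.inr (measure_ne_top _ _))
    have hcl : hmem.toLp ∈ (Submodule.span ℂ (Set.range fun n : Fin d → ℤ =>
      ContinuousMap.toLp (E := ℂ) p (torusMeasure d) ℂ
        (UnitAddTorus.mFourier n))).topologicalClosure := by
      rw [span_mFourier_dense_Lp d hp]; trivial
    obtain ⟨y, hy, hyd⟩ := EMetric.mem_closure_iff.1 hcl δ (by exact_mod_cast hδ0)
    obtain ⟨a, rfl⟩ := (Finsupp.mem_span_range_iff_exists_finsupp).1 hy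
    refine ⟨trigPoly (a.mapRange (fun z : ℂ => z • x) (zero_smul _ _)), ?_, _, rfl⟩
    have hay : (a.sum fun n z => z • ContinuousMap.toLp (E := ℂ) p (torusMeasure d) ℂ
        (UnitAddTorus.mFourier n)) = ContinuousMap.toLp (E := ℂ) p (torusMeasure d) ℂ
          (a.sum fun n z => z • UnitAddTorus.mFourier n) := by
      simp [Finsupp.sum]
    rw [hay, edist_comm, Lp.edist_def] at hyd
    have hbound : ∀ᵐ t ∂torusMeasure d,
        ‖(trigPoly (a.mapRange (fun z : ℂ => z • x) (zero_smul _ _)) -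
          s.indicator fun _ => x) t‖ ≤ ‖x‖ * ‖((ContinuousMap.toLp (E := ℂ) p (torusMeasure d) ℂ
          (a.sum fun n z => z • UnitAddTorus.mFourier n) : UnitAddTorus (Fin d) → ℂ) -
            (hmem.toLp : UnitAddTorus (Fin d) → ℂ)) t‖ := by
      filter_upwards [ContinuousMap.coeFn_toLp (𝕜 := ℂ) (p := p) (torusMeasure d)
        (a.sum fun n z => z • UnitAddTorus.mFourier n), hmem.coeFn_toLp] with t h1 h2
      rw [Pi.sub_apply, Pi.sub_apply, h1, h2, mul_comm, ← norm_smul, sub_smul]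
      refine le_of_eq (congrArg _ (congrArg₂ _ ?_ ?_))
      · rw [trigPoly, Finsupp.sum_mapRange_index (by simp), Finsupp.sum, Finsupp.sum,
          ContinuousMap.sum_apply, Finset.sum_smul]
        refine Finset.sum_congr rfl fun n _ => ?_
        simp [smul_smul, mul_comm]
      · by_cases h : t ∈ s <;> simp [h]
    refine (eLpNorm_le_nnreal_smul_eLpNorm_of_ae_le_mul (c := ‖x‖₊) hbound p).trans ?_
    refine le_trans ?_ hδ
    rw [ENNReal.smul_def, smul_eq_mul]
    exact mul_le_mul_right hyd.le _
  · rintro f g ⟨c, rfl⟩ ⟨c', rfl⟩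
    exact ⟨c + c', (trigPoly_add c c').symm⟩
  · rintro f ⟨c, rfl⟩
    exact (continuous_trigPoly c).aestronglyMeasurable

/-- The Hausdorff-Young inequality on the torus for spaces with Fourier type on `ℝ^d`. -/
theorem HasFourierType.hausdorffYoung_torus [CompleteSpace X] {d : ℕ} {p : ℝ} (hp : 1 < p)
    (hX : HasFourierType X p d) :
    ∃ K : ℝ≥0, ∀ f : UnitAddTorus (Fin d) → X, MemLp f (ENNReal.ofReal p) (torusMeasure d) →
      ∀ S : Finset (Fin d → ℤ),
      (∑ n ∈ S, ‖UnitAddTorus.mFourierCoeff f n‖ₑ ^ p.conjExponent) ^ (1 / p.conjExponent)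
        ≤ K * eLpNorm f (ENNReal.ofReal p) (torusMeasure d) := by
  obtain ⟨K, hK⟩ := hX.trigPoly_le hp
  have hp' : 1 < p.conjExponent := (Real.HolderConjugate.conjExponent hp).symm.lt
  set p' := p.conjExponent
  have h1p : 1 ≤ ENNReal.ofReal p := by rw [ENNReal.one_le_ofReal]; exact hp.le
  have : Fact (1 ≤ ENNReal.ofReal p) := ⟨h1p⟩
  refine ⟨K, fun f hf S => ?_⟩
  -- Total cost of an `ε`-approximation: `K` from the `L^p` norm of the polynomial, and the power of
  -- `S.card` from the remainder, each of whose coefficients is at most `ε`. The dependence on `S`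
  -- is harmless because `ε → 0` with `S` fixed.
  set D : ℝ≥0∞ := K + (S.card : ℝ≥0∞) ^ (1 / p') with hD
  have hDt : D ≠ ∞ := ENNReal.add_ne_top.2 ⟨ENNReal.coe_ne_top,
    ENNReal.rpow_ne_top_of_nonneg (by positivity) (ENNReal.natCast_ne_top _)⟩
  have key : ∀ ε : ℝ≥0, 0 < ε →
      (∑ n ∈ S, ‖UnitAddTorus.mFourierCoeff f n‖ₑ ^ p') ^ (1 / p')
        ≤ K * eLpNorm f (ENNReal.ofReal p) (torusMeasure d) + D * ε := by
    intro ε hε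
    obtain ⟨c, hc⟩ := exists_trigPoly_eLpNorm_sub_le (X := X) ENNReal.ofReal_ne_top hf
      (ε := ε) (by exact_mod_cast hε.ne')
    have hgm : MemLp (trigPoly c) (ENNReal.ofReal p) (torusMeasure d) :=
      (continuous_trigPoly c).memLp_of_hasCompactSupport (HasCompactSupport.of_compactSpace _)
    have hfi := hf.integrable h1p
    have hgi := hgm.integrable h1p
    have hcoef : ∀ n, UnitAddTorus.mFourierCoeff f n =
        c n + UnitAddTorus.mFourierCoeff (f - trigPoly c) n := by
      intro n
      rw [← mFourierCoeff_trigPoly c n, ← mFourierCoeff_add hgi (hfi.sub hgi)]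
      congr 1
      abel
    have hsmall : ∀ n, ‖UnitAddTorus.mFourierCoeff (f - trigPoly c) n‖ₑ ≤ ε := by
      intro n
      refine (enorm_mFourierCoeff_le _ n).trans ?_
      rw [← eLpNorm_one_eq_lintegral_enorm]
      exact (eLpNorm_le_eLpNorm_of_exponent_le h1p
        (hfi.sub hgi).aestronglyMeasurable).trans hc
    calc (∑ n ∈ S, ‖UnitAddTorus.mFourierCoeff f n‖ₑ ^ p') ^ (1 / p')
        ≤ (∑ n ∈ S, (‖c n‖ₑ + ε) ^ p') ^ (1 / p') := by
          gcongr with n _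
          rw [hcoef n]
          exact (enorm_add_le _ _).trans (by gcongr; exact hsmall n)
      _ ≤ (∑ n ∈ S, ‖c n‖ₑ ^ p') ^ (1 / p') + (∑ n ∈ S, (ε : ℝ≥0∞) ^ p') ^ (1 / p') :=
          ENNReal.Lp_add_le _ _ _ hp'.le
      _ ≤ (∑ n ∈ c.support, ‖c n‖ₑ ^ p') ^ (1 / p') + (S.card : ℝ≥0∞) ^ (1 / p') * ε := by
          gcongr ?_ ^ _ + ?_
          · refine Finset.sum_le_sum_of_ne_zero fun n _ hn => ?_
            rw [Finsupp.mem_support_iff]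
            rintro h0
            rw [h0, enorm_zero, ENNReal.zero_rpow_of_pos (by linarith)] at hn
            exact hn rfl
          · rw [Finset.sum_const, nsmul_eq_mul, ENNReal.mul_rpow_of_nonneg _ _ (by positivity),
              ← ENNReal.rpow_mul, mul_one_div_cancel (by linarith), ENNReal.rpow_one]
      _ ≤ K * (eLpNorm f (ENNReal.ofReal p) (torusMeasure d) + ε) +
          (S.card : ℝ≥0∞) ^ (1 / p') * ε := by
          gcongr
          refine (hK c).trans ?_
          gcongr
          have : trigPoly c = f - (f - trigPoly c) := by abel
          rw [this]
          refine (eLpNorm_sub_le hfi.aestronglyMeasurable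
            (hfi.sub hgi).aestronglyMeasurable h1p).trans ?_
          gcongr
      _ = _ := by rw [hD]; ring
  have hlim : Filter.Tendsto
      (fun ε : ℝ≥0 => K * eLpNorm f (ENNReal.ofReal p) (torusMeasure d) + D * ε)
      (nhdsWithin 0 (Set.Ioi 0))
      (nhds (K * eLpNorm f (ENNReal.ofReal p) (torusMeasure d) + D * (0 : ℝ≥0))) :=
    (tendsto_const_nhds.add (ENNReal.Tendsto.const_mul
      (ENNReal.tendsto_coe.2 Filter.tendsto_id) (Or.inr hDt))).mono_left nhdsWithin_le_nhds
  rw [ENNReal.coe_zero, mul_zero, add_zero] at hlim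
  exact ge_of_tendsto hlim (Filter.eventually_of_mem self_mem_nhdsWithin key)

end TrigonometricApproximation

/-! ### Non-increasing rearrangements on a probability space. -/

section Rearrangement

variable {S X : Type*} [MeasurableSpace S] [NormedAddCommGroup X] {μ : Measure S} {f : S → X}

/-- The infimum is attained: as `r` decreases to it, the sets `{r < ‖f‖}` increase, and measures are
continuous along increasing unions. -/
theorem measure_rearrangement_lt_le (μ : Measure S) (f : S → X) (t : ℝ) :
    μ {s | rearrangement μ f t < ‖f s‖ₑ} ≤ ENNReal.ofReal t := by
  have hne : {r : ℝ≥0∞ | μ {s | r < ‖f s‖ₑ} ≤ ENNReal.ofReal t}.Nonempty := ⟨∞, by simp⟩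
  obtain ⟨u, hu, hlim, hmem⟩ := exists_seq_tendsto_sInf hne (OrderBot.bddBelow _)
  have hset : {s | rearrangement μ f t < ‖f s‖ₑ} = ⋃ n, {s | u n < ‖f s‖ₑ} := by
    ext s
    simp only [Set.mem_ofPred_eq, Set.mem_iUnion]
    constructor
    · intro h
      exact (hlim.eventually (eventually_lt_nhds h)).exists
    · rintro ⟨n, hn⟩
      exact (sInf_le (hmem n)).trans_lt hn
  have hmono : Monotone fun n => {s | u n < ‖f s‖ₑ} := fun m n hmn s hs => (hu hmn).trans_lt hs
  rw [hset, hmono.measure_iUnion]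
  exact iSup_le fun n => hmem n

theorem rearrangement_le_iff {t : ℝ} {r : ℝ≥0∞} :
    rearrangement μ f t ≤ r ↔ μ {s | r < ‖f s‖ₑ} ≤ ENNReal.ofReal t := by
  refine ⟨fun h => ?_, fun h => sInf_le h⟩
  exact (measure_mono fun s hs => h.trans_lt hs).trans (measure_rearrangement_lt_le μ f t)

theorem lt_rearrangement_iff {t : ℝ} {r : ℝ≥0∞} :
    r < rearrangement μ f t ↔ ENNReal.ofReal t < μ {s | r < ‖f s‖ₑ} := by
  rw [← not_le, ← not_le, rearrangement_le_iff]

theorem antitone_rearrangement (μ : Measure S) (f : S → X) : Antitone (rearrangement μ f) :=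
  fun _ _ hst => rearrangement_le_iff.2
    ((measure_rearrangement_lt_le μ f _).trans (ENNReal.ofReal_le_ofReal hst))

theorem measurable_rearrangement (μ : Measure S) (f : S → X) : Measurable (rearrangement μ f) :=
  (antitone_rearrangement μ f).measurable

/-- Equimeasurability. With `D = μ {a < ‖f‖}`, a point `t` of `(0, 1)` satisfies `f^*(t) ≤ a`
exactly when `D ≤ t`, so both laws give `Iic a` the mass `1 - D`. -/
theorem map_enorm_eq_map_rearrangement [IsProbabilityMeasure μ] (hf : AEStronglyMeasurable f μ) :
    μ.map (fun s => ‖f s‖ₑ) = (volume.restrict (Set.Ioo 0 1)).map (rearrangement μ f) := by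
  have := Measure.isProbabilityMeasure_map (μ := μ) hf.enorm
  refine Measure.ext_of_Iic _ _ fun a => ?_
  rw [Measure.map_apply_of_aemeasurable hf.enorm measurableSet_Iic,
    Measure.map_apply (measurable_rearrangement μ f) measurableSet_Iic,
    Measure.restrict_apply (measurable_rearrangement μ f measurableSet_Iic)]
  have hc : (fun s => ‖f s‖ₑ) ⁻¹' Set.Iic a = {s | a < ‖f s‖ₑ}ᶜ := by ext s; simp
  have hn : NullMeasurableSet {s | a < ‖f s‖ₑ} μ := nullMeasurableSet_lt aemeasurable_const hf.enorm
  rw [hc, prob_compl_eq_one_sub₀ hn]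
  set D := μ {s | a < ‖f s‖ₑ} with hD
  have hDt : D ≠ ∞ := measure_ne_top _ _
  have hD' : (1 : ℝ≥0∞) - D = ENNReal.ofReal (1 - D.toReal) := by
    rw [ENNReal.ofReal_sub _ ENNReal.toReal_nonneg, ENNReal.ofReal_one, ENNReal.ofReal_toReal hDt]
  rw [hD']
  have hiff : ∀ t : ℝ, 0 < t → (rearrangement μ f t ≤ a ↔ D.toReal ≤ t) := fun t ht => by
    rw [rearrangement_le_iff, ← hD, ENNReal.le_ofReal_iff_toReal_le hDt ht.le]
  refine le_antisymm ?_ ?_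
  · rw [← Real.volume_Ioo]
    refine measure_mono fun t ht => ?_
    have h0 : 0 < t := ENNReal.toReal_nonneg.trans_lt ht.1
    exact ⟨(hiff t h0).2 ht.1.le, h0, ht.2⟩
  · rw [← Real.volume_Icc]
    refine measure_mono fun t ht => ?_
    exact ⟨(hiff t ht.2.1).1 ht.1, ht.2.2.le⟩

theorem lintegral_comp_enorm_eq [IsProbabilityMeasure μ] (hf : AEStronglyMeasurable f μ)
    {φ : ℝ≥0∞ → ℝ≥0∞} (hφ : Measurable φ) :
    ∫⁻ s, φ ‖f s‖ₑ ∂μ = ∫⁻ t in Set.Ioo 0 1, φ (rearrangement μ f t) := by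
  rw [← lintegral_map' hφ.aemeasurable hf.enorm, map_enorm_eq_map_rearrangement hf,
    lintegral_map hφ (measurable_rearrangement μ f)]

theorem ofReal_mul_rearrangement_le (μ : Measure S) (f : S → X) (τ : ℝ) :
    ENNReal.ofReal τ * rearrangement μ f τ ≤ ∫⁻ t in Set.Ioo 0 τ, rearrangement μ f t := by
  calc ENNReal.ofReal τ * rearrangement μ f τ
      = ∫⁻ _ in Set.Ioo 0 τ, rearrangement μ f τ := by
        rw [setLIntegral_const, Real.volume_Ioo, sub_zero, mul_comm]
    _ ≤ _ := setLIntegral_mono' measurableSet_Ioo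
        fun t ht => antitone_rearrangement μ f ht.2.le

/-- By equimeasurability the integral runs over those `t` with `f^*(t) > f^*(τ)`, and monotonicity
forces `t < τ` there. -/
theorem lintegral_large_part_le [IsProbabilityMeasure μ] (hf : AEStronglyMeasurable f μ)
    {τ : ℝ} :
    ∫⁻ s, ‖{s | rearrangement μ f τ < ‖f s‖ₑ}.indicator f s‖ₑ ∂μ
      ≤ ∫⁻ t in Set.Ioo 0 τ, rearrangement μ f t := by
  set lam := rearrangement μ f τ with hlam
  have h := lintegral_comp_enorm_eq hf (φ := (Set.Ioi lam).indicator id)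
    (measurable_id.indicator measurableSet_Ioi)
  have h1 : ∀ s, ‖{s | lam < ‖f s‖ₑ}.indicator f s‖ₑ = (Set.Ioi lam).indicator id ‖f s‖ₑ := by
    intro s
    by_cases hs : lam < ‖f s‖ₑ <;> simp [hs]
  simp only [h1]
  rw [h, ← lintegral_indicator measurableSet_Ioo, ← lintegral_indicator measurableSet_Ioo]
  refine lintegral_mono fun t => ?_
  by_cases ht : t ∈ Set.Ioo (0 : ℝ) 1
  · by_cases hl : lam < rearrangement μ f t
    · have htt : t < τ := by
        by_contra hcon
        exact absurd hl (not_lt.2 (antitone_rearrangement μ f (not_lt.1 hcon)))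
      rw [Set.indicator_of_mem ht, Set.indicator_of_mem (show t ∈ Set.Ioo 0 τ from ⟨ht.1, htt⟩),
        Set.indicator_of_mem (show rearrangement μ f t ∈ Set.Ioi lam from hl)]
      rfl
    · rw [Set.indicator_of_mem ht, Set.indicator_of_notMem
        (show rearrangement μ f t ∉ Set.Ioi lam from hl)]
      exact zero_le
  · rw [Set.indicator_of_notMem ht]
    exact zero_le

/-- The first term accounts for a possible plateau: `f^*` may already equal `f^*(τ)` on part of `(0,
τ]`, and those values survive the truncation. -/
theorem lintegral_small_part_le [IsProbabilityMeasure μ] (hf : AEStronglyMeasurable f μ)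
    {τ p : ℝ} (hp : 0 < p) :
    ∫⁻ s, ‖{s | rearrangement μ f τ < ‖f s‖ₑ}ᶜ.indicator f s‖ₑ ^ p ∂μ
      ≤ ENNReal.ofReal τ * rearrangement μ f τ ^ p
        + ∫⁻ t in Set.Ioo τ 1, rearrangement μ f t ^ p := by
  set lam := rearrangement μ f τ with hlam
  have h := lintegral_comp_enorm_eq hf (φ := (Set.Iic lam).indicator fun x => x ^ p)
    ((measurable_id.pow_const p).indicator measurableSet_Iic)
  have h1 : ∀ s, ‖{s | lam < ‖f s‖ₑ}ᶜ.indicator f s‖ₑ ^ p =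
      (Set.Iic lam).indicator (fun x => x ^ p) ‖f s‖ₑ := by
    intro s
    rcases lt_or_ge lam ‖f s‖ₑ with hs | hs
    · simp [hs, hp]
    · simp [hs, not_lt.2 hs]
  simp only [h1]
  rw [h]
  have hsub : Set.Ioo (0 : ℝ) 1 ⊆ Set.Ioc 0 τ ∪ Set.Ioo τ 1 := by
    intro t ht
    rcases le_or_gt t τ with h2 | h2
    · exact Or.inl ⟨ht.1, h2⟩
    · exact Or.inr ⟨h2, ht.2⟩
  refine (lintegral_mono_set hsub).trans ((lintegral_union_le _ _ _).trans (add_le_add ?_ ?_))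
  · calc _ ≤ ∫⁻ _ in Set.Ioc (0 : ℝ) τ, lam ^ p := by
          refine lintegral_mono fun t => ?_
          by_cases hl : rearrangement μ f t ∈ Set.Iic lam
          · rw [Set.indicator_of_mem hl]
            gcongr
            exact hl
          · rw [Set.indicator_of_notMem hl]
            exact zero_le
      _ = _ := by rw [setLIntegral_const, Real.volume_Ioc, sub_zero, mul_comm]
  · exact lintegral_mono fun t => Set.indicator_le_self _ _ _

end Rearrangement

/-! ### Rearrangements of families indexed by the lattice. -/

section Sequence

variable {d : ℕ} {X : Type*} [NormedAddCommGroup X]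

theorem seqRearrangement_le_of_bound {x : (Fin d → ℤ) → X} {M : ℝ≥0∞} (h : ∀ n, ‖x n‖ₑ ≤ M)
    (k : ℕ) : seqRearrangement x k ≤ M := by
  refine rearrangement_le_iff.2 ?_
  have : {s | M < ‖x s‖ₑ} = ∅ := by ext s; simpa using h s
  simp [this]

/-- Monotonicity includes index `0`: the argument `-1` is truncated to `0`, so the value there is
that at index `1`. -/
theorem antitone_seqRearrangement (x : (Fin d → ℤ) → X) : Antitone (seqRearrangement x) :=
  fun _ _ h => antitone_rearrangement _ _ (by gcongr)

/-- The first `k` terms of the rearrangement are attained, up to a factor, by at most `k` terms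
of the sequence. -/
theorem exists_finset_sum_seqRearrangement_le {x : (Fin d → ℤ) → X} {r : ℝ} (hr : 0 < r)
    (hx : ∀ k, seqRearrangement x k ≠ ∞) (k : ℕ) :
    ∃ S : Finset (Fin d → ℤ), S.card ≤ k ∧
      ∑ j ∈ Finset.Icc 1 k, (seqRearrangement x j / 2) ^ r ≤ ∑ n ∈ S, ‖x n‖ₑ ^ r := by
  classical
  induction k with
  | zero => exact ⟨∅, by simp⟩
  | succ k ih =>
    obtain ⟨S, hS, hsum⟩ := ih
    rw [Finset.sum_Icc_succ_top (by omega)]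
    by_cases h0 : seqRearrangement x (k + 1) = 0
    · exact ⟨S, by omega, by simpa [h0, hr] using hsum⟩
    -- The value of the rearrangement need not be attained by any term. Half of it is exceeded by
    -- more than `k` indices, hence by one outside `S`.
    · have hlt : seqRearrangement x (k + 1) / 2 < seqRearrangement x (k + 1) :=
        ENNReal.half_lt_self h0 (hx _)
      have hlt' := hlt
      conv_rhs at hlt' => rw [seqRearrangement]
      rw [lt_rearrangement_iff] at hlt'
      obtain ⟨n, hn, hnS⟩ : ∃ n, seqRearrangement x (k + 1) / 2 < ‖x n‖ₑ ∧ n ∉ S := by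
        by_contra! hcon
        have hsub : {n | seqRearrangement x (k + 1) / 2 < ‖x n‖ₑ} ⊆ ↑S := fun n hn => hcon n hn
        have := hlt'.trans_le (measure_mono hsub)
        rw [Measure.count_apply_finset] at this
        push_cast at this
        rw [add_sub_cancel_right, ENNReal.ofReal_natCast] at this
        exact absurd hS (not_le.2 (by exact_mod_cast this))
      refine ⟨insert n S, by rw [Finset.card_insert_of_notMem hnS]; omega, ?_⟩
      rw [Finset.sum_insert hnS, add_comm]
      gcongr

end Sequence

/-! ### The `K`-functional estimate. -/

section Interpolation

variable {X : Type*} [NormedAddCommGroup X]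

theorem aestronglyMeasurable_indicator_lt {S : Type*} [MeasurableSpace S] {μ : Measure S}
    {f : S → X} (hf : AEStronglyMeasurable f μ) (r : ℝ≥0∞) :
    AEStronglyMeasurable ({s | r < ‖f s‖ₑ}.indicator f) μ ∧
      AEStronglyMeasurable ({s | r < ‖f s‖ₑ}ᶜ.indicator f) μ := by
  have hn : NullMeasurableSet {s | r < ‖f s‖ₑ} μ := nullMeasurableSet_lt aemeasurable_const hf.enorm
  exact ⟨hf.indicator₀ hn, hf.indicator₀ hn.compl⟩

theorem integrable_of_lintegral_rearrangement_lt_top {S : Type*} [MeasurableSpace S]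
    {μ : Measure S} [IsProbabilityMeasure μ] {f : S → X} (hf : AEStronglyMeasurable f μ)
    (h : ∫⁻ t in Set.Ioo 0 1, rearrangement μ f t < ∞) : Integrable f μ := by
  refine ⟨hf, ?_⟩
  exact (lintegral_comp_enorm_eq hf measurable_id).trans_lt h

theorem lintegral_rearrangement_lt_top {S : Type*} [MeasurableSpace S]
    {μ : Measure S} {f : S → X} {τ : ℝ} (hτ : 0 < τ)
    (h : ∫⁻ t in Set.Ioo 0 τ, rearrangement μ f t < ∞) :
    ∫⁻ t in Set.Ioo 0 1, rearrangement μ f t < ∞ := by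
  have hlam : rearrangement μ f τ ≠ ∞ := by
    intro hcon
    have := (ofReal_mul_rearrangement_le μ f τ).trans_lt h
    rw [hcon, ENNReal.mul_top (by simpa using hτ)] at this
    exact absurd this (by simp)
  have hsub : Set.Ioo (0 : ℝ) 1 ⊆ Set.Ioo 0 τ ∪ Set.Ico τ 1 := by
    intro t ht
    rcases lt_or_ge t τ with h2 | h2
    · exact Or.inl ⟨ht.1, h2⟩
    · exact Or.inr ⟨h2, ht.2⟩
  refine (lintegral_mono_set hsub).trans_lt ((lintegral_union_le _ _ _).trans_lt
    (ENNReal.add_lt_top.2 ⟨h, ?_⟩))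
  calc ∫⁻ t in Set.Ico τ 1, rearrangement μ f t
      ≤ ∫⁻ _ in Set.Ico τ 1, rearrangement μ f τ :=
        setLIntegral_mono' measurableSet_Ico fun t ht => antitone_rearrangement μ f ht.1
    _ < ∞ := by
        rw [setLIntegral_const, Real.volume_Ico]
        exact ENNReal.mul_lt_top (lt_top_iff_ne_top.2 hlam) ENNReal.ofReal_lt_top

/-- The rearrangement of the Fourier coefficients is controlled by that of the function: the
`K`-functional estimate obtained from the `L^1 → ℓ^∞` and the `L^p → ℓ^{p'}` bounds. -/
theorem HasFourierType.sum_seqRearrangement_le [NormedSpace ℂ X] [CompleteSpace X]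
    {d : ℕ} {p : ℝ} (hp : 1 < p)
    (hX : HasFourierType X p d) :
    ∃ C : ℝ≥0, 0 < C ∧ ∀ f : UnitAddTorus (Fin d) → X, AEStronglyMeasurable f (torusMeasure d) →
      ∀ k : ℕ, 1 ≤ k →
      (∑ j ∈ Finset.Icc 1 k,
          seqRearrangement (UnitAddTorus.mFourierCoeff f) j ^ p.conjExponent)
          ^ (1 / p.conjExponent)
        ≤ C * ((k : ℝ≥0∞) ^ (1 / p.conjExponent) *
            (∫⁻ t in Set.Ioo 0 (1 / (k : ℝ)), rearrangement (torusMeasure d) f t) +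
          (∫⁻ t in Set.Ioo (1 / (k : ℝ)) 1, rearrangement (torusMeasure d) f t ^ p)
            ^ (1 / p)) := by
  obtain ⟨K, hK⟩ := hX.hausdorffYoung_torus hp
  have hconj := Real.HolderConjugate.conjExponent hp
  have hp' : 1 < p.conjExponent := hconj.symm.lt
  have hpp' : 1 / p.conjExponent = 1 - 1 / p := by
    have := hconj.inv_add_inv_eq_one
    rw [one_div, one_div]; linarith
  set p' := p.conjExponent
  have hp'0 : 0 < 1 / p' := by positivity
  refine ⟨2 * (1 + K), by positivity, fun f hf k hk => ?_⟩
  set μ := torusMeasure d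
  have hk0 : (0 : ℝ) < k := by exact_mod_cast hk
  set τ : ℝ := 1 / k with hτ
  have hτ0 : 0 < τ := by positivity
  set I := ∫⁻ t in Set.Ioo 0 τ, rearrangement μ f t with hI
  set J := ∫⁻ t in Set.Ioo τ 1, rearrangement μ f t ^ p with hJ
  set lam := rearrangement μ f τ with hlam
  have hkpow : (k : ℝ≥0∞) ^ (1 / p') ≠ 0 := by
    simp only [ne_eq, ENNReal.rpow_eq_zero_iff, not_or, not_and]
    exact ⟨fun h => absurd h (by exact_mod_cast hk0.ne'), fun h => absurd h (by simp)⟩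
  rcases eq_or_ne I ∞ with hIt | hIt
  · rw [hIt, ENNReal.mul_top hkpow, top_add, ENNReal.mul_top (by simp)]
    exact le_top
  have hfi : Integrable f μ := integrable_of_lintegral_rearrangement_lt_top hf
    (lintegral_rearrangement_lt_top hτ0 (lt_top_iff_ne_top.2 hIt))
  have hfin : ∀ j, seqRearrangement (UnitAddTorus.mFourierCoeff f) j ≠ ∞ := fun j =>
    ((seqRearrangement_le_of_bound (enorm_mFourierCoeff_le f) j).trans_lt hfi.2).ne
  obtain ⟨S, hS, hsum⟩ := exists_finset_sum_seqRearrangement_le (r := p') (by linarith) hfin k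
  have hlamI : ENNReal.ofReal τ * lam ≤ I := ofReal_mul_rearrangement_le μ f τ
  have hlamt : lam ≠ ∞ := by
    intro hcon
    rw [hcon, ENNReal.mul_top (by simpa using hτ0)] at hlamI
    exact hIt (top_le_iff.1 hlamI)
  -- Truncation at height `f^*(1/k)`: the large part `f₀` is measured in `L^1`, the bounded part
  -- `f₁` in `L^p`.
  set f₀ := {s | lam < ‖f s‖ₑ}.indicator f with hf₀
  set f₁ := {s | lam < ‖f s‖ₑ}ᶜ.indicator f with hf₁
  have hadd : f = f₀ + f₁ := (Set.indicator_self_add_compl _ f).symm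
  have h0I : ∫⁻ s, ‖f₀ s‖ₑ ∂μ ≤ I := lintegral_large_part_le hf
  obtain ⟨hm0, hm1⟩ := aestronglyMeasurable_indicator_lt hf lam
  have h0int : Integrable f₀ μ := ⟨hm0, h0I.trans_lt (lt_top_iff_ne_top.2 hIt)⟩
  have h1mem : MemLp f₁ (ENNReal.ofReal p) μ := by
    refine MemLp.of_bound hm1 lam.toReal (Filter.Eventually.of_forall fun s => ?_)
    rw [← toReal_enorm]
    refine ENNReal.toReal_mono hlamt ?_
    by_cases hs : lam < ‖f s‖ₑ
    · simp [hf₁, hs]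
    · rw [hf₁, Set.indicator_of_mem (show s ∈ {s | lam < ‖f s‖ₑ}ᶜ from hs)]
      exact not_lt.1 hs
  have h1p : 1 ≤ ENNReal.ofReal p := by rw [ENNReal.one_le_ofReal]; exact hp.le
  have h1int := h1mem.integrable h1p
  -- The plateau term of the small part is absorbed by the `L^1` term: `τ^{1/p} = k^{1/p'} τ` for `τ
  -- = 1/k`, and `τ f^*(τ) ≤ I`.
  have hkτ : ENNReal.ofReal τ ^ (1 / p) * lam ≤ (k : ℝ≥0∞) ^ (1 / p') * I := by
    have hkτ1 : (k : ℝ≥0∞) ^ (1 / p') * ENNReal.ofReal τ = ENNReal.ofReal τ ^ (1 / p) := by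
      rw [hτ, ENNReal.ofReal_rpow_of_pos hτ0, ← ENNReal.ofReal_natCast,
        ENNReal.ofReal_rpow_of_pos hk0, ← ENNReal.ofReal_mul (by positivity), hpp',
        Real.div_rpow zero_le_one hk0.le, Real.one_rpow, Real.rpow_sub hk0, Real.rpow_one]
      congr 1
      field_simp
    rw [← hkτ1, mul_assoc]
    gcongr
  have hnorm : eLpNorm f₁ (ENNReal.ofReal p) μ ≤ (k : ℝ≥0∞) ^ (1 / p') * I + J ^ (1 / p) := by
    rw [eLpNorm_eq_lintegral_rpow_enorm_toReal (by simp; linarith) ENNReal.ofReal_ne_top,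
      ENNReal.toReal_ofReal (by linarith)]
    calc (∫⁻ s, ‖f₁ s‖ₑ ^ p ∂μ) ^ (1 / p)
        ≤ (ENNReal.ofReal τ * lam ^ p + J) ^ (1 / p) := by
          gcongr
          exact lintegral_small_part_le hf (by linarith)
      _ ≤ (ENNReal.ofReal τ * lam ^ p) ^ (1 / p) + J ^ (1 / p) :=
          ENNReal.rpow_add_le_add_rpow _ _ (by positivity) (by
            rw [div_le_one (by linarith)]; exact hp.le)
      _ = ENNReal.ofReal τ ^ (1 / p) * lam + J ^ (1 / p) := by
          rw [ENNReal.mul_rpow_of_nonneg _ _ (by positivity), ← ENNReal.rpow_mul,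
            mul_one_div_cancel (by linarith), ENNReal.rpow_one]
      _ ≤ _ := by gcongr
  have hmain : (∑ n ∈ S, ‖UnitAddTorus.mFourierCoeff f n‖ₑ ^ p') ^ (1 / p') ≤
      (1 + K) * ((k : ℝ≥0∞) ^ (1 / p') * I + J ^ (1 / p)) := by
    calc (∑ n ∈ S, ‖UnitAddTorus.mFourierCoeff f n‖ₑ ^ p') ^ (1 / p')
        ≤ (∑ n ∈ S, (I + ‖UnitAddTorus.mFourierCoeff f₁ n‖ₑ) ^ p') ^ (1 / p') := by
          gcongr with n _
          rw [hadd, mFourierCoeff_add h0int h1int]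
          exact (enorm_add_le _ _).trans
            (by gcongr; exact (enorm_mFourierCoeff_le _ n).trans h0I)
      _ ≤ (∑ n ∈ S, I ^ p') ^ (1 / p') +
          (∑ n ∈ S, ‖UnitAddTorus.mFourierCoeff f₁ n‖ₑ ^ p') ^ (1 / p') :=
          ENNReal.Lp_add_le _ _ _ hp'.le
      _ ≤ (k : ℝ≥0∞) ^ (1 / p') * I + K * ((k : ℝ≥0∞) ^ (1 / p') * I + J ^ (1 / p)) := by
          gcongr
          · rw [Finset.sum_const, nsmul_eq_mul, ENNReal.mul_rpow_of_nonneg _ _ (by positivity),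
              ← ENNReal.rpow_mul, mul_one_div_cancel (by linarith), ENNReal.rpow_one]
            gcongr
          · exact (hK f₁ h1mem S).trans (by gcongr)
      _ ≤ _ := by
          rw [add_mul, one_mul]
          gcongr
          exact le_self_add
  have hhalf : (∑ j ∈ Finset.Icc 1 k,
      (seqRearrangement (UnitAddTorus.mFourierCoeff f) j / 2) ^ p') =
      (2⁻¹ : ℝ≥0∞) ^ p' * ∑ j ∈ Finset.Icc 1 k,
        seqRearrangement (UnitAddTorus.mFourierCoeff f) j ^ p' := by
    rw [Finset.mul_sum]
    refine Finset.sum_congr rfl fun j _ => ?_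
    rw [div_eq_mul_inv, mul_comm, ENNReal.mul_rpow_of_nonneg _ _ (by linarith)]
  rw [hhalf] at hsum
  have h2 := (ENNReal.rpow_le_rpow hsum hp'0.le).trans hmain
  rw [ENNReal.mul_rpow_of_nonneg _ _ hp'0.le, ← ENNReal.rpow_mul,
    mul_one_div_cancel (by linarith), ENNReal.rpow_one,
    ENNReal.inv_mul_le_iff (by simp) (by simp)] at h2
  refine h2.trans (le_of_eq ?_)
  push_cast
  ring

end Interpolation

/-! ### Discrete Hardy inequalities with power and logarithmic weights. -/

section Hardy

/-- Hölder's inequality for the factorization `h = (h u^{-1/q'}) u^{1/q'}`; `u` is the free test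
weight of the Schur argument. -/
theorem lintegral_rpow_le_weighted {α : Type*} [MeasurableSpace α] {μ : Measure α} {q : ℝ}
    (hq : 1 < q) {h u : α → ℝ≥0∞} (hh : AEMeasurable h μ) (hu : AEMeasurable u μ)
    (hu0 : ∀ᵐ x ∂μ, u x ≠ 0) (hut : ∀ᵐ x ∂μ, u x ≠ ∞) :
    (∫⁻ x, h x ∂μ) ^ q ≤ (∫⁻ x, h x ^ q * u x ^ (1 - q) ∂μ) * (∫⁻ x, u x ∂μ) ^ (q - 1) := by
  have hconj := Real.HolderConjugate.conjExponent hq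
  set q' := q.conjExponent
  have hq'0 : q' ≠ 0 := hconj.symm.ne_zero
  have hq0 : q ≠ 0 := hconj.ne_zero
  have hqq : q / q' = q - 1 := by
    have := hconj.inv_add_inv_eq_one
    field_simp at this ⊢
    linarith
  have h1 := ENNReal.lintegral_mul_le_Lp_mul_Lq μ hconj
    (f := fun x => h x * u x ^ (-(1 / q'))) (g := fun x => u x ^ (1 / q'))
    (hh.mul (hu.pow_const _)) (hu.pow_const _)
  have h2 : ∫⁻ x, h x ∂μ = ∫⁻ x, ((fun x => h x * u x ^ (-(1 / q'))) *
      fun x => u x ^ (1 / q')) x ∂μ := by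
    refine lintegral_congr_ae ?_
    filter_upwards [hu0, hut] with x hx0 hxt
    rw [Pi.mul_apply, mul_assoc, ← ENNReal.rpow_add _ _ hx0 hxt, neg_add_cancel, ENNReal.rpow_zero,
      mul_one]
  rw [← h2] at h1
  refine (ENNReal.rpow_le_rpow h1 (by linarith)).trans (le_of_eq ?_)
  rw [ENNReal.mul_rpow_of_nonneg _ _ (by linarith), ← ENNReal.rpow_mul, ← ENNReal.rpow_mul,
    one_div_mul_cancel hq0, ENNReal.rpow_one, one_div_mul_eq_div, hqq]
  congr 2
  · funext x
    rw [ENNReal.mul_rpow_of_nonneg _ _ (by linarith), ← ENNReal.rpow_mul, ← neg_sub q 1, ← hqq]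
    congr 2
    ring
  · refine lintegral_congr fun x => ?_
    rw [← ENNReal.rpow_mul, one_div_mul_cancel hq'0, ENNReal.rpow_one]

/-- A weighted Hardy inequality of Schur test type. -/
theorem tsum_mul_lintegral_rpow_le {α ι : Type*} [MeasurableSpace α] [Countable ι] {μ : Measure α}
    {q : ℝ} (hq : 1 < q) {D : Set α} (hD : MeasurableSet D) {E : ι → Set α}
    (hE : ∀ i, MeasurableSet (E i)) (hED : ∀ i, E i ⊆ D) {h u W : α → ℝ≥0∞}
    (hh : Measurable h) (hu : Measurable u) (hu0 : ∀ x ∈ D, u x ≠ 0) (hut : ∀ x ∈ D, u x ≠ ∞)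
    {c B : ι → ℝ≥0∞} (hB : ∀ i, (∫⁻ x in E i, u x ∂μ) ^ (q - 1) ≤ B i)
    (hW : ∀ x ∈ D, u x ^ (1 - q) * ∑' i, (E i).indicator (fun _ => c i * B i) x ≤ W x) :
    ∑' i, c i * (∫⁻ x in E i, h x ∂μ) ^ q ≤ ∫⁻ x in D, h x ^ q * W x ∂μ := by
  calc ∑' i, c i * (∫⁻ x in E i, h x ∂μ) ^ q
      ≤ ∑' i, ∫⁻ x in D, h x ^ q * u x ^ (1 - q) *
          (E i).indicator (fun _ => c i * B i) x ∂μ := by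
        refine ENNReal.tsum_le_tsum fun i => ?_
        have h1 := lintegral_rpow_le_weighted (μ := μ.restrict (E i)) hq hh.aemeasurable
          hu.aemeasurable ((ae_restrict_iff' (hE i)).2 (.of_forall fun x hx => hu0 x (hED i hx)))
          ((ae_restrict_iff' (hE i)).2 (.of_forall fun x hx => hut x (hED i hx)))
        calc c i * (∫⁻ x in E i, h x ∂μ) ^ q
            ≤ c i * ((∫⁻ x in E i, h x ^ q * u x ^ (1 - q) ∂μ) * B i) := by
              gcongr
              exact h1.trans (by gcongr; exact hB i)
          _ = (∫⁻ x in E i, h x ^ q * u x ^ (1 - q) ∂μ) * (c i * B i) := by ring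
          _ = ∫⁻ x in E i, h x ^ q * u x ^ (1 - q) * (c i * B i) ∂μ := by
              rw [lintegral_mul_const _ (by fun_prop)]
          _ = ∫⁻ x in E i, h x ^ q * u x ^ (1 - q) *
                (E i).indicator (fun _ => c i * B i) x ∂μ := by
              refine setLIntegral_congr_fun (hE i) fun x hx => ?_
              simp only [Set.indicator_of_mem hx]
          _ ≤ _ := lintegral_mono_set (hED i)
    _ = ∫⁻ x in D, ∑' i, h x ^ q * u x ^ (1 - q) *
          (E i).indicator (fun _ => c i * B i) x ∂μ := by
        refine (lintegral_tsum fun i => ?_).symm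
        exact ((by fun_prop : Measurable fun x => h x ^ q * u x ^ (1 - q)).mul
          (measurable_const.indicator (hE i))).aemeasurable
    _ ≤ _ := by
        refine setLIntegral_mono' hD fun x hx => ?_
        rw [ENNReal.tsum_mul_left, mul_assoc]
        gcongr
        exact hW x hx

/-- Convexity of `x ↦ x ^ (-η)`, whose graph lies above its tangent at `y`. After scaling to `y = 1`
it follows from `1 + v ≤ exp v` and `log z ≤ z - 1`. -/
theorem rpow_neg_tangent_le {x y η : ℝ} (hx : 0 < x) (hy : 0 < y) (hη : 0 ≤ η) :
    y ^ (-η) - η * (x - y) * y ^ (-η - 1) ≤ x ^ (-η) := by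
  have hz : 0 < x / y := div_pos hx hy
  have h1 : 1 - η * (x / y - 1) ≤ (x / y) ^ (-η) := by
    rw [Real.rpow_def_of_pos hz]
    have h2 := Real.add_one_le_exp (Real.log (x / y) * -η)
    have h3 := mul_le_mul_of_nonneg_left (Real.log_le_sub_one_of_pos hz) hη
    linarith
  have h4 := mul_le_mul_of_nonneg_right h1 (Real.rpow_nonneg hy.le (-η))
  rw [Real.div_rpow hx.le hy.le, div_mul_cancel₀ _ (Real.rpow_pos_of_pos hy _).ne'] at h4
  refine le_trans (le_of_eq ?_) h4
  rw [Real.rpow_sub_one hy.ne']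
  field_simp

theorem inv_le_log_succ_sub_log {k : ℕ} (hk : 1 ≤ k) :
    1 / ((k : ℝ) + 1) ≤ Real.log (k + 1) - Real.log k := by
  have hk0 : (0 : ℝ) < k := by exact_mod_cast hk
  have := Real.log_le_sub_one_of_pos (show (0 : ℝ) < k / (k + 1) by positivity)
  rw [Real.log_div hk0.ne' (by positivity)] at this
  have h2 : (k : ℝ) / (k + 1) - 1 = -(1 / (k + 1)) := by field_simp; ring
  linarith

theorem log_succ_sub_log_le_inv {k : ℕ} (hk : 1 ≤ k) :
    Real.log (k + 1) - Real.log k ≤ 1 / (k : ℝ) := by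
  have hk0 : (0 : ℝ) < k := by exact_mod_cast hk
  have := Real.log_le_sub_one_of_pos (show (0 : ℝ) < (k + 1) / k by positivity)
  rw [Real.log_div (by positivity) hk0.ne'] at this
  have h2 : ((k : ℝ) + 1) / k - 1 = 1 / k := by field_simp; ring
  linarith

theorem one_le_one_add_log {k : ℕ} : 1 ≤ 1 + Real.log k := by
  linarith [Real.log_natCast_nonneg k]

/-- The tangent at the right endpoint; it makes tails of `k⁻¹ (1 + log k)^{-1-γ}` telescope. -/
theorem one_add_log_succ_le_sub {γ : ℝ} (hγ : 0 ≤ γ) {k : ℕ} (hk : 1 ≤ k) :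
    γ * (1 / ((k : ℝ) + 1) * (1 + Real.log (k + 1)) ^ (-1 - γ)) ≤
      (1 + Real.log k) ^ (-γ) - (1 + Real.log (k + 1)) ^ (-γ) := by
  have h1 : 0 < 1 + Real.log k := by linarith [one_le_one_add_log (k := k)]
  have h2 : 0 < 1 + Real.log ((k : ℝ) + 1) := by
    have := one_le_one_add_log (k := k + 1); push_cast at this; linarith
  have h3 := rpow_neg_tangent_le h1 h2 hγ
  have h4 := inv_le_log_succ_sub_log hk
  have h5 : 0 ≤ (1 + Real.log ((k : ℝ) + 1)) ^ (-1 - γ) := by positivity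
  rw [show -γ - 1 = -1 - γ by ring] at h3
  have h6 := mul_le_mul_of_nonneg_left (mul_le_mul_of_nonneg_right h4 h5) hγ
  linarith

/-- The tangent at the left endpoint; it bounds the differences of the weight in the summation by
parts. -/
theorem sub_le_one_add_log_mul {γ : ℝ} (hγ : 0 ≤ γ) {k : ℕ} (hk : 1 ≤ k) :
    (1 + Real.log k) ^ (-γ) - (1 + Real.log (k + 1)) ^ (-γ) ≤
      γ * (1 / (k : ℝ) * (1 + Real.log k) ^ (-1 - γ)) := by
  have h1 : 0 < 1 + Real.log k := by linarith [one_le_one_add_log (k := k)]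
  have h2 : 0 < 1 + Real.log ((k : ℝ) + 1) := by
    have := one_le_one_add_log (k := k + 1); push_cast at this; linarith
  have h3 := rpow_neg_tangent_le h2 h1 hγ
  have h4 := log_succ_sub_log_le_inv hk
  have h5 : 0 ≤ (1 + Real.log (k : ℝ)) ^ (-1 - γ) := by positivity
  rw [show -γ - 1 = -1 - γ by ring] at h3
  have h6 := mul_le_mul_of_nonneg_left (mul_le_mul_of_nonneg_right h4 h5) hγ
  linarith

/-- Passing from uniform bounds of real partial sums to a bound of a sum over `ℕ+`. -/
theorem tsum_pnat_ofReal_le {f : ℕ → ℝ} (hf : ∀ k, 0 ≤ f k) {M : ℝ}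
    (h : ∀ N, ∑ k ∈ Finset.range N, f (k + 1) ≤ M) :
    ∑' k : ℕ+, ENNReal.ofReal (f k) ≤ ENNReal.ofReal M := by
  rw [tsum_pnat_eq_tsum_succ (f := fun k => ENNReal.ofReal (f k)), ENNReal.tsum_eq_iSup_nat]
  refine iSup_le fun N => ?_
  rw [← ENNReal.ofReal_sum_of_nonneg fun k _ => hf _]
  exact ENNReal.ofReal_le_ofReal (h N)

theorem tsum_rpow_sub_one_le {δ : ℝ} (hδ : 0 < δ) (hδ1 : δ ≤ 1) {t : ℝ} (ht : 0 < t) :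
    ∑' k : ℕ+, ENNReal.ofReal (if t < 1 / (k : ℕ) then ((k : ℕ) : ℝ) ^ (δ - 1) else 0)
      ≤ ENNReal.ofReal (t ^ (-δ) / δ) := by
  refine tsum_pnat_ofReal_le (f := fun k => if t < 1 / (k : ℝ) then (k : ℝ) ^ (δ - 1) else 0)
    (fun k => by split_ifs <;> positivity) fun N => ?_
  -- The minimum makes the induction close: the bound grows while `N < 1/t`, where Bernoulli's
  -- inequality (`δ ≤ 1`) telescopes the terms, and never decreases once they vanish.
  have key : ∑ k ∈ Finset.range N, (if t < 1 / ((k + 1 : ℕ) : ℝ) then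
      ((k + 1 : ℕ) : ℝ) ^ (δ - 1) else 0) ≤ (min (N : ℝ) t⁻¹) ^ δ / δ := by
    induction N with
    | zero => simp; positivity
    | succ N ih =>
      rw [Finset.sum_range_succ]
      push_cast at ih ⊢
      have hN : (0 : ℝ) < N + 1 := by positivity
      split_ifs with hlt
      · have h1 : (N : ℝ) + 1 < t⁻¹ := by
          rw [lt_inv_comm₀ hN ht, ← one_div]; exact hlt
        rw [min_eq_left h1.le]
        rw [min_eq_left (by linarith)] at ih
        have h2 := rpow_one_add_le_one_add_mul_self (s := -(1 / ((N : ℝ) + 1)))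
          (by rw [neg_le_neg_iff, div_le_one hN]; linarith [(Nat.cast_nonneg N : (0 : ℝ) ≤ N)])
          hδ.le hδ1
        have h3 : 1 + -(1 / ((N : ℝ) + 1)) = N / (N + 1) := by field_simp; ring
        rw [h3, Real.div_rpow (Nat.cast_nonneg N) hN.le,
          div_le_iff₀ (Real.rpow_pos_of_pos hN _)] at h2
        rw [Real.rpow_sub_one hN.ne']
        have h4 : ((N : ℝ) + 1) ^ δ / (N + 1) ≤ (((N : ℝ) + 1) ^ δ - (N : ℝ) ^ δ) / δ := by
          rw [le_div_iff₀ hδ]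
          have : (1 + δ * -(1 / ((N : ℝ) + 1))) * ((N : ℝ) + 1) ^ δ =
            ((N : ℝ) + 1) ^ δ - ((N : ℝ) + 1) ^ δ / (N + 1) * δ := by ring
          linarith
        rw [sub_div] at h4
        linarith
      · rw [add_zero]
        refine ih.trans ?_
        gcongr
        linarith
  refine key.trans ?_
  rw [Real.rpow_neg ht.le, ← Real.inv_rpow ht.le]
  gcongr
  exact min_le_right _ _

/-- The first index above `x` costs the summand `1` of the constant; all later terms telescope and
cost `1 / γ`. -/
theorem tsum_one_add_log_tail_le {γ : ℝ} (hγ : 0 < γ) {x : ℝ} (hx : 1 ≤ x) :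
    ∑' k : ℕ+, ENNReal.ofReal
        (if x < (k : ℕ) then 1 / ((k : ℕ) : ℝ) * (1 + Real.log (k : ℕ)) ^ (-1 - γ) else 0)
      ≤ ENNReal.ofReal ((1 + 1 / γ) * (1 + Real.log x) ^ (-γ)) := by
  have hlx : 0 ≤ Real.log x := Real.log_nonneg hx
  refine tsum_pnat_ofReal_le
    (f := fun k => if x < k then 1 / (k : ℝ) * (1 + Real.log k) ^ (-1 - γ) else 0)
    (fun k => by
      have := one_le_one_add_log (k := k)
      split_ifs <;> positivity) fun N => ?_
  have key : (N ≤ x → ∑ k ∈ Finset.range N, (if x < ((k + 1 : ℕ) : ℝ) then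
      1 / ((k + 1 : ℕ) : ℝ) * (1 + Real.log (k + 1 : ℕ)) ^ (-1 - γ) else 0) = 0) ∧
      (x < N → ∑ k ∈ Finset.range N, (if x < ((k + 1 : ℕ) : ℝ) then
      1 / ((k + 1 : ℕ) : ℝ) * (1 + Real.log (k + 1 : ℕ)) ^ (-1 - γ) else 0) ≤
        (1 + 1 / γ) * (1 + Real.log x) ^ (-γ) - 1 / γ * (1 + Real.log N) ^ (-γ)) := by
    induction N with
    | zero => exact ⟨fun _ => by simp, fun h => by norm_num at h; linarith⟩
    | succ N ih =>
      rw [Finset.sum_range_succ]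
      push_cast at ih ⊢
      refine ⟨fun h => ?_, fun h => ?_⟩
      · rw [ih.1 (by linarith), if_neg (not_lt.2 h), add_zero]
      · rw [if_pos h]
        have hlog : Real.log x ≤ Real.log ((N : ℝ) + 1) :=
          Real.log_le_log (by linarith) h.le
        rcases le_or_gt (N : ℝ) x with hN | hN
        · rw [ih.1 hN, zero_add]
          have h1 : (1 + Real.log ((N : ℝ) + 1)) ^ (-γ) ≤ (1 + Real.log x) ^ (-γ) :=
            Real.rpow_le_rpow_of_nonpos (by linarith) (by linarith) (by linarith)
          have h2 : (1 + Real.log ((N : ℝ) + 1)) ^ (-1 - γ) ≤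
              (1 + Real.log ((N : ℝ) + 1)) ^ (-γ) :=
            Real.rpow_le_rpow_of_exponent_le (by linarith) (by linarith)
          have h3 : 1 / ((N : ℝ) + 1) * (1 + Real.log ((N : ℝ) + 1)) ^ (-1 - γ) ≤
              1 * (1 + Real.log ((N : ℝ) + 1)) ^ (-1 - γ) := by
            gcongr
            · have : 0 ≤ 1 + Real.log ((N : ℝ) + 1) := by linarith
              positivity
            · rw [div_le_one (by positivity)]; linarith [(Nat.cast_nonneg N : (0 : ℝ) ≤ N)]
          have h4 := mul_le_mul_of_nonneg_left h1 (show 0 ≤ 1 / γ by positivity)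
          linarith
        · have hN1 : 1 ≤ N := by
            have : (0 : ℝ) < N := by linarith
            exact_mod_cast this
          have h1 := one_add_log_succ_le_sub hγ.le hN1
          have h2 := ih.2 hN
          rw [← le_div_iff₀' hγ] at h1
          have h3 : ((1 + Real.log (N : ℝ)) ^ (-γ) - (1 + Real.log ((N : ℝ) + 1)) ^ (-γ)) / γ =
            1 / γ * (1 + Real.log (N : ℝ)) ^ (-γ) - 1 / γ * (1 + Real.log ((N : ℝ) + 1)) ^ (-γ) := by
              ring
          linarith
  rcases le_or_gt (N : ℝ) x with hN | hN
  · rw [key.1 hN]; positivity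
  · refine (key.2 hN).trans (sub_le_self _ ?_)
    have := one_le_one_add_log (k := N)
    positivity

theorem lintegral_rpow_sub_one_Ioo {β τ : ℝ} (hβ : 0 < β) (hτ : 0 ≤ τ) :
    ∫⁻ t in Set.Ioo 0 τ, ENNReal.ofReal (t ^ (β - 1)) = ENNReal.ofReal (τ ^ β / β) := by
  rw [setLIntegral_congr Ioo_ae_eq_Ioc, ← ofReal_integral_eq_lintegral_ofReal]
  · rw [← intervalIntegral.integral_of_le hτ, integral_rpow (Or.inl (by linarith))]
    simp [hβ.ne']
  · exact (intervalIntegrable_iff_integrableOn_Ioc_of_le hτ).1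
      (intervalIntegral.intervalIntegrable_rpow' (by linarith))
  · exact (ae_restrict_iff' measurableSet_Ioc).2
      (.of_forall fun t ht => Real.rpow_nonneg ht.1.le _)

theorem lintegral_inv_mul_one_sub_log_Ioo_le {τ : ℝ} (hτ : 0 < τ) (hτ1 : τ ≤ 1) :
    ∫⁻ t in Set.Ioo τ 1, ENNReal.ofReal (t⁻¹ * (1 - Real.log t) ^ (-(1 / 2) : ℝ))
      ≤ ENNReal.ofReal (2 * (1 - Real.log τ) ^ (1 / 2 : ℝ)) := by
  have hpos : ∀ t ∈ Set.Icc τ 1, 0 < t ∧ 0 < 1 - Real.log t := fun t ht =>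
    ⟨hτ.trans_le ht.1, by linarith [Real.log_nonpos (hτ.le.trans ht.1) ht.2]⟩
  have hcont : ContinuousOn (fun t : ℝ => t⁻¹ * (1 - Real.log t) ^ (-(1 / 2) : ℝ))
      (Set.uIcc τ 1) := by
    rw [Set.uIcc_of_le hτ1]
    refine ContinuousOn.mul (continuousOn_id.inv₀ fun t ht => (hpos t ht).1.ne')
      (ContinuousOn.rpow_const (continuousOn_const.sub
        (continuousOn_id.log fun t ht => (hpos t ht).1.ne')) fun t ht => Or.inl (hpos t ht).2.ne')
  rw [setLIntegral_congr Ioo_ae_eq_Ioc, ← ofReal_integral_eq_lintegral_ofReal]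
  · rw [← intervalIntegral.integral_of_le hτ1,
      intervalIntegral.integral_eq_sub_of_hasDerivAt
        (f := fun t => -(2 * (1 - Real.log t) ^ (1 / 2 : ℝ))) _ hcont.intervalIntegrable]
    · refine ENNReal.ofReal_le_ofReal ?_
      simp
    · intro t ht
      rw [Set.uIcc_of_le hτ1] at ht
      have h1 := (((Real.hasDerivAt_log (hpos t ht).1.ne').const_sub 1).rpow_const (p := 1 / 2)
        (Or.inl (hpos t ht).2.ne')).const_mul 2 |>.neg
      refine h1.congr_deriv ?_
      norm_num
      ring
  · exact (intervalIntegrable_iff_integrableOn_Ioc_of_le hτ1).1 hcont.intervalIntegrable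
  · exact (ae_restrict_iff' measurableSet_Ioc).2 (.of_forall fun t ht => by
      have := hpos t ⟨ht.1.le, ht.2⟩
      have h1 := this.1
      have h2 := this.2
      positivity)

/-- Hardy's inequality for integrals near zero, sampled at `t = 1/k`, via the Schur test with a
power weight. -/
theorem tsum_rpow_mul_lintegral_Ioo_le {q θ : ℝ} (hq : 1 < q) (hθ : 0 < θ) :
    ∃ C : ℝ≥0, ∀ h : ℝ → ℝ≥0∞, Measurable h →
      ∑' k : ℕ+, ENNReal.ofReal (((k : ℕ) : ℝ) ^ (q * θ - 1)) *
          (∫⁻ t in Set.Ioo 0 (1 / ((k : ℕ) : ℝ)), h t) ^ q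
        ≤ C * ∫⁻ t in Set.Ioo 0 1, h t ^ q * ENNReal.ofReal (t ^ (q * (1 - θ) - 1)) := by
  -- The test weight is `t^{β-1}`. The bound `δ < q * θ` gives `β > 0`, hence integrability at zero;
  -- `β` is chosen so that the Schur sum becomes `∑_{k < 1/t} k^{δ-1}`, which is `O(t^{-δ})` for `0
  -- < δ ≤ 1`.
  set δ := min 1 (q * θ / 2) with hδdef
  have hqθ : 0 < q * θ := by positivity
  have hδ0 : 0 < δ := lt_min one_pos (by positivity)
  have hδ1 : δ ≤ 1 := min_le_left _ _
  have hδ2 : δ < q * θ := (min_le_right _ _).trans_lt (by linarith)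
  have hq1 : 0 < q - 1 := by linarith
  set β := (q * θ - δ) / (q - 1) with hβ
  have hβ0 : 0 < β := div_pos (by linarith) hq1
  have hβq : β * (q - 1) = q * θ - δ := div_mul_cancel₀ _ hq1.ne'
  set A : ℝ := (1 / β) ^ (q - 1) with hA
  have hA0 : 0 < A := by positivity
  refine ⟨Real.toNNReal (A / δ), fun h hh => ?_⟩
  rw [← lintegral_const_mul _ (by fun_prop)]
  refine (tsum_mul_lintegral_rpow_le (D := Set.Ioo (0 : ℝ) 1) hq measurableSet_Ioo
    (E := fun k : ℕ+ => Set.Ioo 0 (1 / ((k : ℕ) : ℝ)))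
    (u := fun t => ENNReal.ofReal (t ^ (β - 1)))
    (B := fun k => ENNReal.ofReal (A * ((k : ℕ) : ℝ) ^ (-(q * θ - δ))))
    (W := fun t => ENNReal.ofReal (A / δ * t ^ (q * (1 - θ) - 1)))
    (fun k => measurableSet_Ioo) ?_ hh (by fun_prop) ?_ ?_ ?_ ?_).trans (le_of_eq ?_)
  · intro k
    refine Set.Ioo_subset_Ioo_right ?_
    rw [div_le_one (by exact_mod_cast k.pos)]
    exact_mod_cast k.pos
  · intro t ht
    simpa using Real.rpow_pos_of_pos ht.1 _
  · intro t _
    exact ENNReal.ofReal_ne_top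
  · intro k
    have hk : (0 : ℝ) < (k : ℕ) := by exact_mod_cast k.pos
    rw [lintegral_rpow_sub_one_Ioo hβ0 (by positivity),
      ENNReal.ofReal_rpow_of_nonneg (by positivity) hq1.le]
    refine ENNReal.ofReal_le_ofReal (le_of_eq ?_)
    rw [hA, ← hβq, div_eq_mul_one_div _ β, Real.mul_rpow (by positivity) (by positivity),
      ← Real.rpow_mul (by positivity), mul_comm, one_div ((k : ℕ) : ℝ), Real.inv_rpow hk.le,
      Real.rpow_neg hk.le]
  · intro t ht
    have h1 : ∀ k : ℕ+, (Set.Ioo 0 (1 / ((k : ℕ) : ℝ))).indicator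
        (fun _ => ENNReal.ofReal (((k : ℕ) : ℝ) ^ (q * θ - 1)) *
          ENNReal.ofReal (A * ((k : ℕ) : ℝ) ^ (-(q * θ - δ)))) t =
        ENNReal.ofReal A *
          ENNReal.ofReal (if t < 1 / (k : ℕ) then ((k : ℕ) : ℝ) ^ (δ - 1) else 0) := by
      intro k
      have hk : (0 : ℝ) < (k : ℕ) := by exact_mod_cast k.pos
      by_cases hlt : t < 1 / ((k : ℕ) : ℝ)
      · rw [Set.indicator_of_mem (show t ∈ Set.Ioo 0 (1 / ((k : ℕ) : ℝ)) from ⟨ht.1, hlt⟩),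
          if_pos hlt, ← ENNReal.ofReal_mul (by positivity), ← ENNReal.ofReal_mul hA0.le]
        congr 1
        rw [mul_left_comm, ← Real.rpow_add hk]
        congr 2
        ring
      · rw [Set.indicator_of_notMem (fun hmem => hlt hmem.2), if_neg hlt]
        simp
    simp only [h1]
    rw [ENNReal.tsum_mul_left]
    refine (mul_le_mul_right (mul_le_mul_right (tsum_rpow_sub_one_le hδ0 hδ1 ht.1) _) _).trans ?_
    rw [ENNReal.ofReal_rpow_of_pos (Real.rpow_pos_of_pos ht.1 _), ← Real.rpow_mul ht.1.le,
      ← ENNReal.ofReal_mul hA0.le, ← ENNReal.ofReal_mul (Real.rpow_nonneg ht.1.le _)]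
    refine ENNReal.ofReal_le_ofReal (le_of_eq ?_)
    calc t ^ ((β - 1) * (1 - q)) * (A * (t ^ (-δ) / δ))
        = A / δ * (t ^ ((β - 1) * (1 - q)) * t ^ (-δ)) := by ring
      _ = _ := by
        rw [← Real.rpow_add ht.1]
        congr 2
        linear_combination -hβq
  · refine setLIntegral_congr_fun measurableSet_Ioo fun t ht => ?_
    rw [ENNReal.ofReal_mul (by positivity), mul_left_comm]
    rfl

/-- The endpoint case: in the variable `log (1/t)` this is the classical Hardy inequality with
exponent `r > 1`, which is what the power `-r` of the logarithm reflects. -/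
theorem tsum_log_mul_lintegral_Ioo_le {r : ℝ} (hr : 1 < r) :
    ∃ C : ℝ≥0, ∀ h : ℝ → ℝ≥0∞, Measurable h →
      ∑' k : ℕ+, ENNReal.ofReal (1 / ((k : ℕ) : ℝ) * (1 + Real.log (k : ℕ)) ^ (-r)) *
          (∫⁻ t in Set.Ioo (1 / ((k : ℕ) : ℝ)) 1, h t) ^ r
        ≤ C * ∫⁻ t in Set.Ioo 0 1, h t ^ r * ENNReal.ofReal (t ^ (r - 1)) := by
  have hr1 : 0 < r - 1 := by linarith
  -- The test weight `t⁻¹ (1 - log t)^{-1/2}` has integral at most `2 (1 + log k)^{1/2}` over `(1/k,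
  -- 1)`, whose power `r - 1` is `A (1 + log k)^γ`. The sum left over has terms `k⁻¹ (1 + log
  -- k)^{-1-γ}`, and its tail cancels the factor `(1 - log t)^γ` of `u^{1-r}`.
  set γ := (r - 1) / 2 with hγ
  have hγ0 : 0 < γ := by positivity
  set A : ℝ := 2 ^ (r - 1) with hA
  have hA0 : 0 < A := by positivity
  refine ⟨Real.toNNReal (A * (1 + 1 / γ)), fun h hh => ?_⟩
  rw [← lintegral_const_mul _ (by fun_prop)]
  refine (tsum_mul_lintegral_rpow_le (D := Set.Ioo (0 : ℝ) 1) hr measurableSet_Ioo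
    (E := fun k : ℕ+ => Set.Ioo (1 / ((k : ℕ) : ℝ)) 1)
    (u := fun t => ENNReal.ofReal (t⁻¹ * (1 - Real.log t) ^ (-(1 / 2) : ℝ)))
    (B := fun k => ENNReal.ofReal (A * (1 + Real.log (k : ℕ)) ^ γ))
    (W := fun t => ENNReal.ofReal (A * (1 + 1 / γ) * t ^ (r - 1)))
    (fun k => measurableSet_Ioo) ?_ hh (by fun_prop) ?_ ?_ ?_ ?_).trans (le_of_eq ?_)
  · intro k
    exact Set.Ioo_subset_Ioo_left (by positivity)
  · intro t ht
    have h1 : 0 < 1 - Real.log t := by linarith [Real.log_nonpos ht.1.le ht.2.le]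
    have h2 := ht.1
    have : 0 < t⁻¹ * (1 - Real.log t) ^ (-(1 / 2) : ℝ) := by positivity
    simpa using this
  · intro t _
    exact ENNReal.ofReal_ne_top
  · intro k
    have hk : (0 : ℝ) < (k : ℕ) := by exact_mod_cast k.pos
    have hl := one_le_one_add_log (k := k)
    have h1 := lintegral_inv_mul_one_sub_log_Ioo_le (τ := 1 / ((k : ℕ) : ℝ)) (by positivity)
      (by rw [div_le_one hk]; exact_mod_cast k.pos)
    refine (ENNReal.rpow_le_rpow h1 hr1.le).trans ?_
    rw [one_div, Real.log_inv, sub_neg_eq_add,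
      ENNReal.ofReal_rpow_of_nonneg (by positivity) hr1.le]
    refine ENNReal.ofReal_le_ofReal (le_of_eq ?_)
    rw [Real.mul_rpow (by positivity) (by positivity), ← Real.rpow_mul (by positivity)]
    congr 2
    rw [hγ]; ring
  · intro t ht
    have hlt0 : 0 < 1 - Real.log t := by linarith [Real.log_nonpos ht.1.le ht.2.le]
    have ht0 := ht.1
    have h1 : ∀ k : ℕ+, (Set.Ioo (1 / ((k : ℕ) : ℝ)) 1).indicator
        (fun _ => ENNReal.ofReal (1 / ((k : ℕ) : ℝ) * (1 + Real.log (k : ℕ)) ^ (-r)) *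
          ENNReal.ofReal (A * (1 + Real.log (k : ℕ)) ^ γ)) t =
        ENNReal.ofReal A *
          ENNReal.ofReal (if t⁻¹ < (k : ℕ) then
            1 / ((k : ℕ) : ℝ) * (1 + Real.log (k : ℕ)) ^ (-1 - γ) else 0) := by
      intro k
      have hk : (0 : ℝ) < (k : ℕ) := by exact_mod_cast k.pos
      have hl := one_le_one_add_log (k := k)
      have hiff : 1 / ((k : ℕ) : ℝ) < t ↔ t⁻¹ < (k : ℕ) := by
        rw [one_div, inv_lt_comm₀ hk ht0]
      by_cases hlt : t⁻¹ < (k : ℕ)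
      · rw [Set.indicator_of_mem (show t ∈ Set.Ioo (1 / ((k : ℕ) : ℝ)) 1 from
          ⟨hiff.2 hlt, ht.2⟩), if_pos hlt, ← ENNReal.ofReal_mul (by positivity),
          ← ENNReal.ofReal_mul hA0.le]
        congr 1
        have : (1 + Real.log (k : ℕ)) ^ (-1 - γ) =
            (1 + Real.log (k : ℕ)) ^ (-r) * (1 + Real.log (k : ℕ)) ^ γ := by
          rw [← Real.rpow_add (by linarith)]
          congr 1
          rw [hγ]; ring
        rw [this]; ring
      · rw [Set.indicator_of_notMem (fun hmem => hlt (hiff.1 hmem.1)), if_neg hlt]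
        simp
    simp only [h1]
    rw [ENNReal.tsum_mul_left]
    refine (mul_le_mul_right (mul_le_mul_right
      (tsum_one_add_log_tail_le hγ0 ((one_le_inv₀ ht0).2 ht.2.le)) _) _).trans ?_
    rw [Real.log_inv, ← sub_eq_add_neg, ENNReal.ofReal_rpow_of_pos (by positivity),
      ← ENNReal.ofReal_mul hA0.le, ← ENNReal.ofReal_mul (by positivity)]
    refine ENNReal.ofReal_le_ofReal (le_of_eq ?_)
    rw [Real.mul_rpow (by positivity) (by positivity), ← Real.rpow_mul hlt0.le,
      Real.inv_rpow ht0.le, ← Real.rpow_neg ht0.le, neg_sub,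
      show -(1 / 2) * (1 - r) = γ by rw [hγ]; ring, Real.rpow_neg hlt0.le]
    have := (Real.rpow_pos_of_pos hlt0 γ).ne'
    field_simp
  · refine setLIntegral_congr_fun measurableSet_Ioo fun t ht => ?_
    rw [ENNReal.ofReal_mul (by positivity), mul_left_comm]
    rfl

end Hardy

/-! ### Summation by parts with logarithmic weights. -/

section Summation

/-- Abel summation as an interchange of sums: the weight is dominated by a tail sum of `d`, which
leaves the partial sums of `y`. -/
theorem tsum_mul_le_of_sum_le {w y d Y : ℕ → ℝ≥0∞}
    (hw : ∀ k, w k ≤ ∑' j, if k ≤ j then d j else 0)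
    (hY : ∀ j, ∑ k ∈ Finset.range (j + 1), y k ≤ Y j) :
    ∑' k, w k * y k ≤ ∑' j, d j * Y j := by
  calc ∑' k, w k * y k ≤ ∑' k, ∑' j, (if k ≤ j then d j * y k else 0) := by
        refine ENNReal.tsum_le_tsum fun k => ?_
        refine (mul_le_mul_left (hw k) _).trans (le_of_eq ?_)
        rw [← ENNReal.tsum_mul_right]
        simp only [ite_mul, zero_mul]
    _ = ∑' j, ∑' k, (if k ≤ j then d j * y k else 0) := ENNReal.tsum_comm
    _ ≤ _ := by
        refine ENNReal.tsum_le_tsum fun j => ?_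
        rw [tsum_eq_sum (s := Finset.range (j + 1))]
        · refine le_trans (le_of_eq ?_) (mul_le_mul_right (hY j) (d j))
          rw [Finset.mul_sum]
          refine Finset.sum_congr rfl fun k hk => ?_
          rw [if_pos (by rw [Finset.mem_range] at hk; omega)]
        · intro k hk
          rw [if_neg (by rw [Finset.mem_range] at hk; omega)]

theorem ofReal_le_tsum_of_sub_le {w d : ℕ → ℝ} (hd : ∀ k, 0 ≤ d k)
    (hw : ∀ k, w k - w (k + 1) ≤ d k) (hlim : Filter.Tendsto w Filter.atTop (nhds 0)) (k : ℕ) :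
    ENNReal.ofReal (w k) ≤ ∑' j, if k ≤ j then ENNReal.ofReal (d j) else 0 := by
  have hstep : ∀ N, k ≤ N → w k - w N ≤ ∑ j ∈ Finset.Ico k N, d j := by
    intro N hN
    induction N, hN using Nat.le_induction with
    | base => simp
    | succ N hN ih =>
      rw [Finset.sum_Ico_succ_top hN]
      linarith [hw N]
  have h1 : ∀ N, k ≤ N → ENNReal.ofReal (w k - w N) ≤
      ∑' j, if k ≤ j then ENNReal.ofReal (d j) else 0 := by
    intro N hN
    refine (ENNReal.ofReal_le_ofReal (hstep N hN)).trans ?_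
    rw [ENNReal.ofReal_sum_of_nonneg fun j _ => hd j]
    refine le_trans (le_of_eq ?_) (ENNReal.sum_le_tsum (Finset.Ico k N))
    refine Finset.sum_congr rfl fun j hj => ?_
    rw [if_pos (Finset.mem_Ico.1 hj).1]
  have h2 : Filter.Tendsto (fun N => ENNReal.ofReal (w k - w N)) Filter.atTop
      (nhds (ENNReal.ofReal (w k - 0))) :=
    ENNReal.tendsto_ofReal (tendsto_const_nhds.sub hlim)
  rw [sub_zero] at h2
  exact le_of_tendsto h2 (Filter.eventually_atTop.2 ⟨k, h1⟩)

theorem tendsto_one_add_log_rpow_neg {η : ℝ} (hη : 0 < η) :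
    Filter.Tendsto (fun k : ℕ => (1 + Real.log ((k + 1 : ℕ) : ℝ)) ^ (-η)) Filter.atTop (nhds 0) := by
  refine (tendsto_rpow_neg_atTop hη).comp ?_
  refine Filter.tendsto_atTop_add_const_left _ _ ?_
  exact Real.tendsto_log_atTop.comp
    (tendsto_natCast_atTop_atTop.comp (Filter.tendsto_add_atTop_nat 1))

/-- A discrete form of `(G^s)' = s G^{s-1} G'`. Dividing by `(G + a)^s` reduces it to comparing `1 -
x` with `1 - x^s` for `x = G / (G + a)` in `[0, 1]`: `x^s ≤ x` if `s ≥ 1`, Bernoulli if `s ≤ 1`. -/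
theorem mul_rpow_sub_one_le_sub {s a G : ℝ} (hs : 0 < s) (ha : 0 ≤ a) (hG : 0 ≤ G) :
    a * (G + a) ^ (s - 1) ≤ max 1 (1 / s) * ((G + a) ^ s - G ^ s) := by
  rcases (add_nonneg hG ha).eq_or_lt with h0 | hpos
  · have hG0 : G = 0 := by linarith
    have ha0 : a = 0 := by linarith
    simp [hG0, ha0]
  have hx0 : 0 ≤ G / (G + a) := by positivity
  have hx1 : G / (G + a) ≤ 1 := by rw [div_le_one hpos]; linarith
  have hxa : 1 - G / (G + a) = a / (G + a) := by field_simp; ring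
  have key : 1 - G / (G + a) ≤ max 1 (1 / s) * (1 - (G / (G + a)) ^ s) := by
    rcases le_total 1 s with h1 | h1
    · have h2 : (G / (G + a)) ^ s ≤ G / (G + a) := by
        simpa using Real.rpow_le_rpow_of_exponent_ge' hx0 hx1 zero_le_one h1
      calc 1 - G / (G + a) ≤ 1 * (1 - (G / (G + a)) ^ s) := by linarith
        _ ≤ _ := by
          gcongr
          · linarith
          · exact le_max_left _ _
    · have h2 := rpow_one_add_le_one_add_mul_self (s := G / (G + a) - 1) (by linarith) hs.le h1
      rw [add_sub_cancel] at h2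
      calc 1 - G / (G + a) = 1 / s * (s * (1 - G / (G + a))) := by field_simp
        _ ≤ 1 / s * (1 - (G / (G + a)) ^ s) := by
          gcongr
          linarith
        _ ≤ _ := by
          have : (G / (G + a)) ^ s ≤ 1 := Real.rpow_le_one hx0 hx1 hs.le
          gcongr
          · exact le_max_right _ _
  rw [hxa] at key
  have h3 := mul_le_mul_of_nonneg_right key (Real.rpow_nonneg hpos.le s)
  rw [Real.div_rpow hG hpos.le] at h3
  have hne := (Real.rpow_pos_of_pos hpos s).ne'
  rw [Real.rpow_sub_one hpos.ne']
  refine le_trans (le_of_eq ?_) (h3.trans (le_of_eq ?_))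
  · ring
  · field_simp

theorem sum_mul_rpow_sub_one_le {s : ℝ} (hs : 0 < s) {a : ℕ → ℝ} (ha : ∀ k, 0 ≤ a k) (k : ℕ) :
    ∑ i ∈ Finset.range k, a (i + 1) * (∑ j ∈ Finset.Icc 1 (i + 1), a j) ^ (s - 1) ≤
      max 1 (1 / s) * (∑ j ∈ Finset.Icc 1 k, a j) ^ s := by
  induction k with
  | zero => simp [hs.ne']
  | succ k ih =>
    rw [Finset.sum_range_succ, Finset.sum_Icc_succ_top (by omega)]
    have := mul_rpow_sub_one_le_sub hs (ha (k + 1))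
      (Finset.sum_nonneg fun j _ => ha j : 0 ≤ ∑ j ∈ Finset.Icc 1 k, a j)
    rw [mul_sub] at this
    linarith

/-- The source of the gain `min s 1`, with `κ` in the role of the index. For `s ≥ 1`, replacing `(κ
a)^{s-1}` by `G^{s-1}` gives the first term alone. For `s ≤ 1`, `y^s ≤ y + 1` with `y = L κ a / G`
produces both terms. -/
theorem weighted_rpow_le {s r a G L κ : ℝ} (hs : 0 < s) (ha : 0 ≤ a) (hκ : 0 < κ) (hL : 1 ≤ L)
    (haG : κ * a ≤ G) :
    1 / κ * (κ * a) ^ s * L ^ (-r + min s 1) ≤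
      L ^ (1 - r) * (a * G ^ (s - 1)) + 1 / κ * L ^ (-r) * G ^ s := by
  have hL0 : 0 < L := by linarith
  have hG : 0 ≤ G := le_trans (by positivity) haG
  rcases le_total 1 s with h1 | h1
  · rw [min_eq_right h1]
    have h2 : 1 / κ * (κ * a) ^ s ≤ a * G ^ (s - 1) := by
      rcases ha.eq_or_lt with h0 | h0
      · simp [← h0, hs.ne']
      · calc 1 / κ * (κ * a) ^ s = a * (κ * a) ^ (s - 1) := by
              rw [Real.rpow_sub_one (by positivity)]; field_simp
          _ ≤ _ := by
              gcongr
    calc 1 / κ * (κ * a) ^ s * L ^ (-r + 1) ≤ a * G ^ (s - 1) * L ^ (-r + 1) := by gcongr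
      _ = L ^ (1 - r) * (a * G ^ (s - 1)) := by rw [mul_comm, neg_add_eq_sub]
      _ ≤ _ := le_add_of_nonneg_right (by positivity)
  · rw [min_eq_left h1]
    rcases hG.eq_or_lt with h0 | h0
    · have : a = 0 := by nlinarith
      have hz : (0 : ℝ) ^ s = 0 := Real.zero_rpow hs.ne'
      simp [this, ← h0, hz]
    · set y := L * (κ * a) / G with hy
      have hy0 : 0 ≤ y := by positivity
      have hys : y ^ s ≤ y + 1 := by
        rcases le_total y 1 with h2 | h2
        · exact (Real.rpow_le_one hy0 h2 hs.le).trans (by linarith)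
        · have := Real.rpow_le_rpow_of_exponent_le h2 h1
          rw [Real.rpow_one] at this
          linarith
      have hy2 : y ^ s * G ^ s = L ^ s * (κ * a) ^ s := by
        rw [← Real.mul_rpow hy0 hG, hy, div_mul_cancel₀ _ h0.ne',
          Real.mul_rpow hL0.le (by positivity)]
      calc 1 / κ * (κ * a) ^ s * L ^ (-r + s)
          = 1 / κ * L ^ (-r) * (y ^ s * G ^ s) := by
            rw [hy2, Real.rpow_add hL0]; ring
        _ ≤ 1 / κ * L ^ (-r) * ((y + 1) * G ^ s) := by gcongr
        _ = _ := by
            rw [hy, Real.rpow_sub hL0, Real.rpow_one, Real.rpow_neg hL0.le,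
              Real.rpow_sub_one h0.ne']
            have := (Real.rpow_pos_of_pos hL0 r).ne'
            field_simp

theorem mul_le_sum_Icc_of_antitone {a : ℕ → ℝ} (ha : Antitone a) (k : ℕ) :
    k * a k ≤ ∑ j ∈ Finset.Icc 1 k, a j := by
  have := Finset.card_nsmul_le_sum (Finset.Icc 1 k) a (a k)
    fun j hj => ha (Finset.mem_Icc.1 hj).2
  simpa using this

/-- Summation by parts: a logarithmically weighted sum of a non-increasing sequence is controlled
by a sum of its partial sums, with the weight improved by a power of the logarithm. -/
theorem tsum_antitone_le_tsum_partial_sums {r s : ℝ} (hr : 1 < r) (hs : 0 < s) :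
    ∃ C : ℝ≥0, ∀ a : ℕ → ℝ, (∀ k, 0 ≤ a k) → Antitone a →
      ∑' k : ℕ+, ENNReal.ofReal (1 / ((k : ℕ) : ℝ) * ((k : ℕ) * a k) ^ s *
          (1 + Real.log (k : ℕ)) ^ (-r + min s 1)) ≤
        C * ∑' k : ℕ+, ENNReal.ofReal (1 / ((k : ℕ) : ℝ) * (1 + Real.log (k : ℕ)) ^ (-r) *
          (∑ j ∈ Finset.Icc 1 (k : ℕ), a j) ^ s) := by
  set M := max 1 (1 / s) with hM
  have hM0 : 0 < M := lt_of_lt_of_le one_pos (le_max_left _ _)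
  have hr1 : 0 < r - 1 := by linarith
  refine ⟨Real.toNNReal ((r - 1) * M) + 1, fun a ha hanti => ?_⟩
  set G : ℕ → ℝ := fun k => ∑ j ∈ Finset.Icc 1 k, a j with hG
  have hG0 : ∀ k, 0 ≤ G k := fun k => Finset.sum_nonneg fun j _ => ha j
  set L : ℕ → ℝ := fun k => 1 + Real.log (k : ℝ) with hLdef
  have hL1 : ∀ k, 1 ≤ L k := fun k => one_le_one_add_log
  have hL0 : ∀ k, 0 < L k := fun k => one_pos.trans_le (hL1 k)
  rw [tsum_pnat_eq_tsum_succ (f := fun k : ℕ => ENNReal.ofReal (1 / (k : ℝ) * (k * a k) ^ s *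
      L k ^ (-r + min s 1))),
    tsum_pnat_eq_tsum_succ (f := fun k : ℕ => ENNReal.ofReal (1 / (k : ℝ) * L k ^ (-r) *
      G k ^ s))]
  -- The weight `L^{1-r}` tends to zero since `r > 1` and has differences at most `(r - 1) k⁻¹
  -- L^{-r}`, while the partial sums of `a G^{s-1}` are at most `M G^s`.
  have habel : ∑' k : ℕ, ENNReal.ofReal (L (k + 1) ^ (-(r - 1))) *
      ENNReal.ofReal (a (k + 1) * G (k + 1) ^ (s - 1)) ≤
      ∑' k : ℕ, ENNReal.ofReal ((r - 1) * (1 / ((k + 1 : ℕ) : ℝ) * L (k + 1) ^ (-r))) *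
        ENNReal.ofReal (M * G (k + 1) ^ s) := by
    refine tsum_mul_le_of_sum_le (fun k => ?_) (fun j => ?_)
    · refine ofReal_le_tsum_of_sub_le (w := fun k => L (k + 1) ^ (-(r - 1)))
        (d := fun k => (r - 1) * (1 / ((k + 1 : ℕ) : ℝ) * L (k + 1) ^ (-r))) (fun k => ?_)
        (fun k => ?_) (tendsto_one_add_log_rpow_neg hr1) k
      · have := hL0 (k + 1)
        positivity
      · have := sub_le_one_add_log_mul hr1.le (show 1 ≤ k + 1 by omega)
        rw [show -1 - (r - 1) = -r by ring] at this
        refine le_trans (le_of_eq ?_) this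
        simp [hLdef]
    · rw [← ENNReal.ofReal_sum_of_nonneg fun k _ =>
        mul_nonneg (ha _) (Real.rpow_nonneg (hG0 _) _)]
      exact ENNReal.ofReal_le_ofReal (sum_mul_rpow_sub_one_le hs ha (j + 1))
  calc ∑' k : ℕ, ENNReal.ofReal (1 / ((k + 1 : ℕ) : ℝ) * ((k + 1 : ℕ) * a (k + 1)) ^ s *
        L (k + 1) ^ (-r + min s 1))
      ≤ ∑' k : ℕ, (ENNReal.ofReal (L (k + 1) ^ (-(r - 1))) *
          ENNReal.ofReal (a (k + 1) * G (k + 1) ^ (s - 1)) +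
          ENNReal.ofReal (1 / ((k + 1 : ℕ) : ℝ) * L (k + 1) ^ (-r) * G (k + 1) ^ s)) := by
        refine ENNReal.tsum_le_tsum fun k => ?_
        have h1 := hL0 (k + 1)
        have h2 := hG0 (k + 1)
        rw [← ENNReal.ofReal_mul (by positivity), ← ENNReal.ofReal_add
          (mul_nonneg (by positivity) (mul_nonneg (ha _) (by positivity))) (by positivity),
          neg_sub]
        exact ENNReal.ofReal_le_ofReal (weighted_rpow_le hs (ha _) (by positivity) (hL1 _)
          (mul_le_sum_Icc_of_antitone hanti (k + 1)))
    _ ≤ _ := by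
        rw [ENNReal.tsum_add, ENNReal.coe_add, add_mul, ENNReal.coe_one, one_mul]
        refine add_le_add (habel.trans (le_of_eq ?_)) le_rfl
        rw [← ENNReal.tsum_mul_left]
        refine tsum_congr fun k => ?_
        have h1 := hL0 (k + 1)
        change _ = ENNReal.ofReal _ * _
        rw [← ENNReal.ofReal_mul (by positivity), ← ENNReal.ofReal_mul (by positivity)]
        congr 1
        ring

end Summation

/-! ### Lorentz norms on a probability space. -/

section LorentzNorms

variable {S X : Type*} [MeasurableSpace S] [NormedAddCommGroup X]

theorem setOf_ofReal_lt_univ_eq_Ioo (μ : Measure S) [IsProbabilityMeasure μ] :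
    {t : ℝ | 0 < t ∧ ENNReal.ofReal t < μ Set.univ} = Set.Ioo 0 1 := by
  ext t
  simp [ENNReal.ofReal_lt_one]

theorem lorentzNorm_eq_of_ne_top (μ : Measure S) [IsProbabilityMeasure μ] {p : ℝ} {q : ℝ≥0∞}
    (hq : q ≠ ∞) (f : S → X) :
    lorentzNorm μ p q f = (∫⁻ t in Set.Ioo 0 1, rearrangement μ f t ^ q.toReal *
      ENNReal.ofReal (t ^ (q.toReal / p - 1))) ^ (1 / q.toReal) := by
  rw [lorentzNorm, lorentzZygmundNorm, if_neg hq, setOf_ofReal_lt_univ_eq_Ioo]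
  congr 1
  refine setLIntegral_congr_fun measurableSet_Ioo fun t ht => ?_
  have ht0 := ht.1
  rw [Real.rpow_zero, mul_one, ENNReal.mul_rpow_of_nonneg _ _ ENNReal.toReal_nonneg,
    ENNReal.ofReal_rpow_of_nonneg (by positivity) ENNReal.toReal_nonneg, ← Real.rpow_mul ht0.le,
    one_div_mul_eq_div, mul_right_comm, ← ENNReal.ofReal_mul (by positivity), mul_comm,
    Real.rpow_sub_one ht0.ne', mul_one_div]

theorem rearrangement_le_lorentzNorm_top (μ : Measure S) [IsProbabilityMeasure μ] (p : ℝ)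
    (f : S → X) {t : ℝ} (ht : t ∈ Set.Ioo 0 1) :
    rearrangement μ f t ≤ lorentzNorm μ p ∞ f * ENNReal.ofReal (t ^ (-(1 / p))) := by
  have ht0 := ht.1
  have h1 : ENNReal.ofReal (t ^ (1 / p)) * rearrangement μ f t ≤ lorentzNorm μ p ∞ f := by
    rw [lorentzNorm, lorentzZygmundNorm, if_pos rfl, setOf_ofReal_lt_univ_eq_Ioo]
    refine le_trans (le_of_eq ?_) (le_iSup₂ (f := fun t (_ : t ∈ Set.Ioo (0 : ℝ) 1) =>
      ENNReal.ofReal (t ^ (1 / p) * (1 + |Real.log t|) ^ (0 : ℝ)) * rearrangement μ f t) t ht)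
    rw [Real.rpow_zero, mul_one]
  calc rearrangement μ f t
      = ENNReal.ofReal (t ^ (1 / p)) * rearrangement μ f t *
          ENNReal.ofReal (t ^ (-(1 / p))) := by
        rw [mul_right_comm, ← ENNReal.ofReal_mul (by positivity), ← Real.rpow_add ht0,
          add_neg_cancel, Real.rpow_zero, ENNReal.ofReal_one, one_mul]
    _ ≤ _ := by gcongr

theorem lintegral_inv_Ioo {τ : ℝ} (hτ : 0 < τ) (hτ1 : τ ≤ 1) :
    ∫⁻ t in Set.Ioo τ 1, ENNReal.ofReal t⁻¹ = ENNReal.ofReal (-Real.log τ) := by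
  have hpos : ∀ t ∈ Set.uIcc τ 1, t ≠ 0 := fun t ht => by
    rw [Set.uIcc_of_le hτ1] at ht
    exact (hτ.trans_le ht.1).ne'
  have hint : IntervalIntegrable (fun t : ℝ => t⁻¹) volume τ 1 :=
    (continuousOn_id.inv₀ hpos).intervalIntegrable
  rw [setLIntegral_congr Ioo_ae_eq_Ioc, ← ofReal_integral_eq_lintegral_ofReal]
  · rw [← intervalIntegral.integral_of_le hτ1, integral_inv_of_pos hτ one_pos, one_div,
      Real.log_inv]
  · exact (intervalIntegrable_iff_integrableOn_Ioc_of_le hτ1).1 hint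
  · exact (ae_restrict_iff' measurableSet_Ioc).2
      (.of_forall fun t ht => inv_nonneg.2 (hτ.le.trans ht.1.le))

end LorentzNorms

/-! ### Lorentz-Zygmund sequence norms and pointwise decay. -/

section SequenceNorms

variable {d : ℕ} {X : Type*} [NormedAddCommGroup X]

theorem rpow_mul_seqRearrangement_le (x : (Fin d → ℤ) → X) {p' : ℝ} (hp' : 0 < p') {k : ℕ} :
    (k : ℝ≥0∞) ^ (1 / p') * seqRearrangement x k ≤
      (∑ j ∈ Finset.Icc 1 k, seqRearrangement x j ^ p') ^ (1 / p') := by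
  have h := Finset.card_nsmul_le_sum (Finset.Icc 1 k) (fun j => seqRearrangement x j ^ p')
    (seqRearrangement x k ^ p') fun j hj => by
      have := antitone_seqRearrangement x (Finset.mem_Icc.1 hj).2
      gcongr
  rw [Nat.card_Icc, Nat.add_sub_cancel, nsmul_eq_mul] at h
  refine le_trans (le_of_eq ?_) (ENNReal.rpow_le_rpow h (by positivity))
  rw [ENNReal.mul_rpow_of_nonneg _ _ (by positivity), ← ENNReal.rpow_mul,
    mul_one_div_cancel hp'.ne', ENNReal.rpow_one]

/-- The increments of `n^s` are at most `max 1 s` times `n^{s-1}`: Bernoulli for `s ≥ 1`, and `x ≤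
x^s` on `[0, 1]` for `s ≤ 1`. -/
theorem rpow_le_max_mul_sum_rpow_sub_one {s : ℝ} (hs : 0 < s) (n : ℕ) :
    (n : ℝ) ^ s ≤ max 1 s * ∑ i ∈ Finset.range n, ((i + 1 : ℕ) : ℝ) ^ (s - 1) := by
  induction n with
  | zero => simp [hs.ne']
  | succ n ih =>
    rw [Finset.sum_range_succ, mul_add]
    refine (?_ : _ ≤ (n : ℝ) ^ s + _).trans (add_le_add_left ih _)
    have hn : (0 : ℝ) < n + 1 := by positivity
    push_cast
    have hfrac : 1 - (n : ℝ) / (n + 1) = 1 / (n + 1) := by field_simp; ring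
    have hx0 : 0 ≤ (n : ℝ) / (n + 1) := by positivity
    have hx1 : (n : ℝ) / (n + 1) ≤ 1 := by rw [div_le_one hn]; linarith
    have key : 1 - ((n : ℝ) / (n + 1)) ^ s ≤ max 1 s * (1 / (n + 1)) := by
      rw [← hfrac]
      have h0 : 0 ≤ 1 - (n : ℝ) / (n + 1) := by linarith
      rcases le_total 1 s with h1 | h1
      · have h2 := one_add_mul_self_le_rpow_one_add (s := (n : ℝ) / (n + 1) - 1) (by linarith) h1
        rw [add_sub_cancel] at h2
        rw [max_eq_right h1]
        linarith
      · have h2 : (n : ℝ) / (n + 1) ≤ ((n : ℝ) / (n + 1)) ^ s := by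
          simpa using Real.rpow_le_rpow_of_exponent_ge' hx0 hx1 hs.le h1
        rw [max_eq_left h1]
        linarith
    have h3 := mul_le_mul_of_nonneg_right key (Real.rpow_nonneg hn.le s)
    have hne := (Real.rpow_pos_of_pos hn s).ne'
    rw [Real.div_rpow (Nat.cast_nonneg n) hn.le, sub_mul, one_mul, div_mul_cancel₀ _ hne] at h3
    rw [Real.rpow_sub_one hn.ne', ← mul_one_div, mul_comm (((n : ℝ) + 1) ^ s), ← mul_assoc]
    linarith

theorem seqLorentzZygmundNorm_eq_of_ne_top {p' b : ℝ} {q : ℝ≥0∞} (hq : q ≠ ∞)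
    (x : (Fin d → ℤ) → X) :
    seqLorentzZygmundNorm p' q b x = (∑' k : ℕ+, ENNReal.ofReal (((k : ℕ) : ℝ) ^ (q.toReal / p' - 1)
      * (1 + Real.log (k : ℕ)) ^ (b * q.toReal)) * seqRearrangement x k ^ q.toReal)
        ^ (1 / q.toReal) := by
  rw [seqLorentzZygmundNorm, if_neg hq]
  congr 1
  refine tsum_congr fun k => ?_
  have hk : (0 : ℝ) < (k : ℕ) := by exact_mod_cast k.pos
  have hL : 0 < 1 + Real.log (k : ℕ) := one_pos.trans_le one_le_one_add_log
  rw [ENNReal.mul_rpow_of_nonneg _ _ ENNReal.toReal_nonneg,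
    ENNReal.ofReal_rpow_of_nonneg (by positivity) ENNReal.toReal_nonneg, mul_right_comm,
    ← ENNReal.ofReal_mul (by positivity), Real.mul_rpow (by positivity) (by positivity),
    ← Real.rpow_mul hk.le, ← Real.rpow_mul hL.le, one_div_mul_eq_div, Real.rpow_sub_one hk.ne']
  congr 2
  ring

/-- Pointwise decay of the rearrangement of a sequence in a Lorentz-Zygmund space. -/
theorem exists_seqRearrangement_le_seqLorentzZygmundNorm {p' b : ℝ} (hp' : 0 < p') (hb : b ≤ 0)
    {q : ℝ≥0∞} (hq0 : q ≠ 0) :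
    ∃ C : ℝ≥0, ∀ x : (Fin d → ℤ) → X, ∀ n : ℕ, 1 ≤ n →
      ENNReal.ofReal ((n : ℝ) ^ (1 / p') * (1 + Real.log n) ^ b) * seqRearrangement x n ≤
        C * seqLorentzZygmundNorm p' q b x := by
  rcases eq_or_ne q ∞ with rfl | hq
  · refine ⟨1, fun x n hn => ?_⟩
    rw [seqLorentzZygmundNorm, if_pos rfl, ENNReal.coe_one, one_mul]
    exact le_iSup (fun k : ℕ+ => ENNReal.ofReal (((k : ℕ) : ℝ) ^ (1 / p') *
      (1 + Real.log (k : ℕ)) ^ b) * seqRearrangement x k) ⟨n, hn⟩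
  set Q := q.toReal with hQ
  have hQ0 : 0 < Q := ENNReal.toReal_pos hq0 hq
  set s := Q / p' with hs
  have hs0 : 0 < s := div_pos hQ0 hp'
  set M := max 1 s
  have hM0 : 0 < M := one_pos.trans_le (le_max_left _ _)
  have hbQ : b * Q ≤ 0 := mul_nonpos_of_nonpos_of_nonneg hb hQ0.le
  refine ⟨Real.toNNReal (M ^ (1 / Q)), fun x n hn => ?_⟩
  have hn0 : (0 : ℝ) < n := by exact_mod_cast hn
  have hL : ∀ k : ℕ, 0 < 1 + Real.log (k : ℝ) := fun k => one_pos.trans_le one_le_one_add_log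
  have hLn := hL n
  rw [seqLorentzZygmundNorm_eq_of_ne_top hq, tsum_pnat_eq_tsum_succ
    (f := fun k : ℕ => ENNReal.ofReal ((k : ℝ) ^ (s - 1) * (1 + Real.log (k : ℝ)) ^ (b * Q)) *
      seqRearrangement x k ^ Q)]
  have key : ENNReal.ofReal ((n : ℝ) ^ s * (1 + Real.log n) ^ (b * Q)) *
      seqRearrangement x n ^ Q ≤ ENNReal.ofReal M * ∑' k : ℕ,
        ENNReal.ofReal (((k + 1 : ℕ) : ℝ) ^ (s - 1) *
          (1 + Real.log ((k + 1 : ℕ) : ℝ)) ^ (b * Q)) * seqRearrangement x (k + 1) ^ Q := by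
    -- Only the first `n` terms are kept. As `b ≤ 0`, both the logarithmic weight and the
    -- rearrangement are smallest at `n`, so they come out of the sum.
    refine le_trans ?_ (mul_le_mul_right (ENNReal.sum_le_tsum (Finset.range n)) _)
    calc ENNReal.ofReal ((n : ℝ) ^ s * (1 + Real.log n) ^ (b * Q)) * seqRearrangement x n ^ Q
        ≤ ENNReal.ofReal (M * ∑ i ∈ Finset.range n, ((i + 1 : ℕ) : ℝ) ^ (s - 1) *
            (1 + Real.log n) ^ (b * Q)) * seqRearrangement x n ^ Q := by
          refine mul_le_mul_left (ENNReal.ofReal_le_ofReal ?_) _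
          rw [← Finset.sum_mul, ← mul_assoc]
          gcongr
          exact rpow_le_max_mul_sum_rpow_sub_one hs0 n
      _ = ENNReal.ofReal M * ∑ i ∈ Finset.range n, ENNReal.ofReal (((i + 1 : ℕ) : ℝ) ^ (s - 1) *
            (1 + Real.log n) ^ (b * Q)) * seqRearrangement x n ^ Q := by
          rw [ENNReal.ofReal_mul hM0.le, ENNReal.ofReal_sum_of_nonneg (fun i _ => by positivity),
            mul_assoc, Finset.sum_mul]
      _ ≤ _ := by
          gcongr ENNReal.ofReal M * ?_
          refine Finset.sum_le_sum fun i hi => ?_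
          have hin : i + 1 ≤ n := Finset.mem_range.1 hi
          have h1 := hL (i + 1)
          have h2 : Real.log ((i + 1 : ℕ) : ℝ) ≤ Real.log n :=
            Real.log_le_log (by positivity) (by exact_mod_cast hin)
          refine mul_le_mul' (ENNReal.ofReal_le_ofReal ?_)
            (ENNReal.rpow_le_rpow (antitone_seqRearrangement x hin) hQ0.le)
          exact mul_le_mul_of_nonneg_left
            (Real.rpow_le_rpow_of_nonpos h1 (by linarith) hbQ) (by positivity)
  have h3 := ENNReal.rpow_le_rpow key (show 0 ≤ 1 / Q by positivity)
  rw [ENNReal.mul_rpow_of_nonneg _ _ (by positivity), ENNReal.mul_rpow_of_nonneg _ _ (by positivity),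
    ← ENNReal.rpow_mul, mul_one_div_cancel hQ0.ne', ENNReal.rpow_one,
    ENNReal.ofReal_rpow_of_pos (by positivity), ENNReal.ofReal_rpow_of_pos hM0,
    Real.mul_rpow (by positivity) (by positivity), ← Real.rpow_mul hn0.le, ← Real.rpow_mul hLn.le,
    mul_assoc b, mul_one_div_cancel hQ0.ne', mul_one,
    show s * (1 / Q) = 1 / p' by rw [hs]; field_simp] at h3
  exact h3

end SequenceNorms

/-! ### Boundedness of the Fourier transform. -/

section Main

variable {X : Type*} [NormedAddCommGroup X] [NormedSpace ℂ X] [CompleteSpace X]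

/-- With `f^*(t) ≤ N t^{-1/p}`, the integral near zero scales exactly like `k^{-1/p'}`, while
`(f^*)^p ≤ N^p / t` away from zero costs `(log k)^{1/p}`, the loss recorded by the weight. -/
theorem HasFourierType.seqLorentzZygmundNorm_top_le {d : ℕ} {p : ℝ} (hp : 1 < p)
    (hX : HasFourierType X p d) :
    ∃ C : ℝ≥0, ∀ f : UnitAddTorus (Fin d) → X, MemLorentz (torusMeasure d) p ∞ f →
      Integrable f (torusMeasure d) ∧
      seqLorentzZygmundNorm p.conjExponent ∞ (-(1 / p)) (UnitAddTorus.mFourierCoeff f)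
        ≤ C * lorentzNorm (torusMeasure d) p ∞ f := by
  obtain ⟨C, -, hC⟩ := hX.sum_seqRearrangement_le hp
  have hconj := Real.HolderConjugate.conjExponent hp
  have hp' : 1 < p.conjExponent := hconj.symm.lt
  have hpp' : 1 / p.conjExponent = 1 - 1 / p := by
    have := hconj.inv_add_inv_eq_one
    rw [one_div, one_div]; linarith
  set p' := p.conjExponent
  have hp'0 : 0 < 1 / p' := by positivity
  have hp0 : 0 < p := by linarith
  refine ⟨C * Real.toNNReal (p' + 1), fun f hf => ?_⟩
  set μ := torusMeasure d
  set N := lorentzNorm μ p ∞ f with hN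
  have hI : ∀ k : ℕ, 1 ≤ k → ∫⁻ t in Set.Ioo 0 (1 / (k : ℝ)), rearrangement μ f t ≤
      N * ENNReal.ofReal (p' * (k : ℝ) ^ (-(1 / p'))) := by
    intro k hk
    have hk0 : (0 : ℝ) < k := by exact_mod_cast hk
    have hk1 : 1 / (k : ℝ) ≤ 1 := by rw [div_le_one hk0]; exact_mod_cast hk
    calc ∫⁻ t in Set.Ioo 0 (1 / (k : ℝ)), rearrangement μ f t
        ≤ ∫⁻ t in Set.Ioo 0 (1 / (k : ℝ)), N * ENNReal.ofReal (t ^ (1 / p' - 1)) := by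
          refine setLIntegral_mono' measurableSet_Ioo fun t ht => ?_
          rw [show 1 / p' - 1 = -(1 / p) by rw [hpp']; ring]
          exact rearrangement_le_lorentzNorm_top μ p f ⟨ht.1, ht.2.trans_le hk1⟩
      _ = N * ENNReal.ofReal (p' * (k : ℝ) ^ (-(1 / p'))) := by
          rw [lintegral_const_mul _ (by fun_prop),
            lintegral_rpow_sub_one_Ioo hp'0 (by positivity), one_div (k : ℝ),
            Real.inv_rpow hk0.le, Real.rpow_neg hk0.le, div_div_eq_mul_div, div_one, mul_comm p']
  have hJ : ∀ k : ℕ, 1 ≤ k →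
      (∫⁻ t in Set.Ioo (1 / (k : ℝ)) 1, rearrangement μ f t ^ p) ^ (1 / p) ≤
      N * ENNReal.ofReal ((1 + Real.log k) ^ (1 / p)) := by
    intro k hk
    have hk0 : (0 : ℝ) < k := by exact_mod_cast hk
    have hk1 : 1 / (k : ℝ) ≤ 1 := by rw [div_le_one hk0]; exact_mod_cast hk
    have hkl : 0 ≤ Real.log k := Real.log_natCast_nonneg k
    have h1 : ∫⁻ t in Set.Ioo (1 / (k : ℝ)) 1, rearrangement μ f t ^ p ≤
        N ^ p * ENNReal.ofReal (1 + Real.log k) := by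
      calc ∫⁻ t in Set.Ioo (1 / (k : ℝ)) 1, rearrangement μ f t ^ p
          ≤ ∫⁻ t in Set.Ioo (1 / (k : ℝ)) 1, N ^ p * ENNReal.ofReal t⁻¹ := by
            refine setLIntegral_mono' measurableSet_Ioo fun t ht => ?_
            have ht0 : 0 < t := lt_trans (by positivity) ht.1
            refine (ENNReal.rpow_le_rpow
              (rearrangement_le_lorentzNorm_top μ p f ⟨ht0, ht.2⟩) hp0.le).trans (le_of_eq ?_)
            rw [ENNReal.mul_rpow_of_nonneg _ _ hp0.le, ENNReal.ofReal_rpow_of_pos (by positivity),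
              ← Real.rpow_mul ht0.le, neg_mul, one_div_mul_cancel hp0.ne', Real.rpow_neg_one]
        _ = N ^ p * ENNReal.ofReal (Real.log k) := by
            rw [lintegral_const_mul _ (by fun_prop), lintegral_inv_Ioo (by positivity) hk1,
              one_div, Real.log_inv, neg_neg]
        _ ≤ _ := by
            gcongr
            linarith
    refine (ENNReal.rpow_le_rpow h1 (by positivity)).trans (le_of_eq ?_)
    rw [ENNReal.mul_rpow_of_nonneg _ _ (by positivity), ← ENNReal.rpow_mul,
      mul_one_div_cancel hp0.ne', ENNReal.rpow_one,
      ENNReal.ofReal_rpow_of_nonneg (by positivity) (by positivity)]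
  refine ⟨?_, ?_⟩
  · refine integrable_of_lintegral_rearrangement_lt_top hf.1 ?_
    have := hI 1 le_rfl
    rw [Nat.cast_one, div_one] at this
    exact this.trans_lt (ENNReal.mul_lt_top hf.2 ENNReal.ofReal_lt_top)
  · rw [seqLorentzZygmundNorm, if_pos rfl]
    refine iSup_le fun k => ?_
    have hk1 : 1 ≤ (k : ℕ) := k.pos
    have hk0 : (0 : ℝ) < (k : ℕ) := by exact_mod_cast k.pos
    have hL := one_le_one_add_log (k := k)
    have hL0 : 0 < 1 + Real.log (k : ℕ) := by linarith
    have h1 := (rpow_mul_seqRearrangement_le (UnitAddTorus.mFourierCoeff f)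
      (show 0 < p' by linarith) (k := k)).trans (hC f hf.1 k hk1)
    have h2 : ((k : ℕ) : ℝ≥0∞) ^ (1 / p') * (∫⁻ t in Set.Ioo 0 (1 / ((k : ℕ) : ℝ)),
        rearrangement μ f t) ≤ N * ENNReal.ofReal (p' * (1 + Real.log (k : ℕ)) ^ (1 / p)) := by
      refine (mul_le_mul_right (hI k hk1) _).trans ?_
      rw [mul_left_comm, ← ENNReal.ofReal_natCast, ENNReal.ofReal_rpow_of_pos hk0,
        ← ENNReal.ofReal_mul (by positivity), mul_left_comm, ← Real.rpow_add hk0,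
        add_neg_cancel, Real.rpow_zero]
      gcongr
      exact Real.one_le_rpow hL (by positivity)
    have h3 : ((k : ℕ) : ℝ≥0∞) ^ (1 / p') * seqRearrangement (UnitAddTorus.mFourierCoeff f) k ≤
        C * (N * ENNReal.ofReal ((p' + 1) * (1 + Real.log (k : ℕ)) ^ (1 / p))) := by
      refine h1.trans ?_
      rw [add_mul, one_mul, ENNReal.ofReal_add (by positivity) (by positivity), mul_add N]
      gcongr
      exact hJ k hk1
    calc ENNReal.ofReal (((k : ℕ) : ℝ) ^ (1 / p') * (1 + Real.log (k : ℕ)) ^ (-(1 / p))) *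
          seqRearrangement (UnitAddTorus.mFourierCoeff f) k
        = ENNReal.ofReal ((1 + Real.log (k : ℕ)) ^ (-(1 / p))) * (((k : ℕ) : ℝ≥0∞) ^ (1 / p') *
          seqRearrangement (UnitAddTorus.mFourierCoeff f) k) := by
          rw [mul_comm (((k : ℕ) : ℝ) ^ (1 / p')), ENNReal.ofReal_mul (by positivity), mul_assoc,
            ← ENNReal.ofReal_natCast, ENNReal.ofReal_rpow_of_pos hk0]
      _ ≤ ENNReal.ofReal ((1 + Real.log (k : ℕ)) ^ (-(1 / p))) *
          (C * (N * ENNReal.ofReal ((p' + 1) * (1 + Real.log (k : ℕ)) ^ (1 / p)))) := by gcongr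
      _ = C * N * ENNReal.ofReal ((1 + Real.log (k : ℕ)) ^ (-(1 / p)) *
            ((p' + 1) * (1 + Real.log (k : ℕ)) ^ (1 / p))) := by
          rw [ENNReal.ofReal_mul (p := (1 + Real.log (k : ℕ)) ^ (-(1 / p))) (by positivity)]
          ring
      _ = C * N * ENNReal.ofReal (p' + 1) := by
          rw [mul_left_comm, ← Real.rpow_add hL0, neg_add_cancel, Real.rpow_zero, mul_one]
      _ = _ := by
          rw [ENNReal.coe_mul]
          change _ = C * ENNReal.ofReal (p' + 1) * N
          ring

/-- The near part of the `K`-functional estimate needs no logarithm and falls to the power-weight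
Hardy inequality with `θ = 1/p'`. The far part is the endpoint inequality for `(f^*)^p` with
exponent `Q/p > 1`. -/
theorem HasFourierType.tsum_partial_sums_le {d : ℕ} {p : ℝ} (hp : 1 < p)
    (hX : HasFourierType X p d) {Q : ℝ} (hQ : p < Q) :
    ∃ C : ℝ≥0, ∀ f : UnitAddTorus (Fin d) → X, AEStronglyMeasurable f (torusMeasure d) →
      ∑' k : ℕ+, ENNReal.ofReal (1 / ((k : ℕ) : ℝ) * (1 + Real.log (k : ℕ)) ^ (-(Q / p))) *
        (∑ j ∈ Finset.Icc 1 (k : ℕ), seqRearrangement (UnitAddTorus.mFourierCoeff f) j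
          ^ p.conjExponent) ^ (Q / p.conjExponent)
        ≤ C * ∫⁻ t in Set.Ioo 0 1, rearrangement (torusMeasure d) f t ^ Q *
            ENNReal.ofReal (t ^ (Q / p - 1)) := by
  obtain ⟨C, -, hC⟩ := hX.sum_seqRearrangement_le hp
  have hconj := Real.HolderConjugate.conjExponent hp
  have hp' : 1 < p.conjExponent := hconj.symm.lt
  have hpp' : 1 - 1 / p.conjExponent = 1 / p := by
    have := hconj.inv_add_inv_eq_one
    rw [one_div, one_div]; linarith
  set p' := p.conjExponent
  have hp0 : 0 < p := by linarith
  have hQ1 : 1 < Q := by linarith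
  have hQp : 1 < Q / p := by rwa [one_lt_div hp0]
  obtain ⟨A, hA⟩ := tsum_rpow_mul_lintegral_Ioo_le (q := Q) (θ := 1 / p') hQ1 (by positivity)
  obtain ⟨B, hB⟩ := tsum_log_mul_lintegral_Ioo_le hQp
  have hDt : (C : ℝ≥0∞) ^ Q * 2 ^ (Q - 1) ≠ ∞ :=
    ENNReal.mul_ne_top (ENNReal.rpow_ne_top_of_nonneg (by linarith) ENNReal.coe_ne_top)
      (ENNReal.rpow_ne_top_of_nonneg (by linarith) (by simp))
  refine ⟨((C : ℝ≥0∞) ^ Q * 2 ^ (Q - 1)).toNNReal * (A + B), fun f hf => ?_⟩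
  set μ := torusMeasure d
  set D := (C : ℝ≥0∞) ^ Q * 2 ^ (Q - 1) with hD
  set Φ := ∫⁻ t in Set.Ioo 0 1, rearrangement μ f t ^ Q * ENNReal.ofReal (t ^ (Q / p - 1)) with hΦ
  have h1 := hA _ (measurable_rearrangement μ f)
  rw [hpp', mul_one_div, mul_one_div] at h1
  have h2 := hB (fun t => rearrangement μ f t ^ p) ((measurable_rearrangement μ f).pow_const p)
  simp only [← ENNReal.rpow_mul, mul_div_cancel₀ Q hp0.ne'] at h2
  calc ∑' k : ℕ+, ENNReal.ofReal (1 / ((k : ℕ) : ℝ) * (1 + Real.log (k : ℕ)) ^ (-(Q / p))) *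
        (∑ j ∈ Finset.Icc 1 (k : ℕ), seqRearrangement (UnitAddTorus.mFourierCoeff f) j ^ p')
          ^ (Q / p')
      ≤ ∑' k : ℕ+, D * (ENNReal.ofReal (((k : ℕ) : ℝ) ^ (Q / p' - 1)) *
          (∫⁻ t in Set.Ioo 0 (1 / ((k : ℕ) : ℝ)), rearrangement μ f t) ^ Q +
          ENNReal.ofReal (1 / ((k : ℕ) : ℝ) * (1 + Real.log (k : ℕ)) ^ (-(Q / p))) *
          (∫⁻ t in Set.Ioo (1 / ((k : ℕ) : ℝ)) 1, rearrangement μ f t ^ p) ^ (Q / p)) := by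
        refine ENNReal.tsum_le_tsum fun k => ?_
        have hk0 : (0 : ℝ) < (k : ℕ) := by exact_mod_cast k.pos
        have hL := one_le_one_add_log (k := k)
        set I := ∫⁻ t in Set.Ioo 0 (1 / ((k : ℕ) : ℝ)), rearrangement μ f t
        set J := ∫⁻ t in Set.Ioo (1 / ((k : ℕ) : ℝ)) 1, rearrangement μ f t ^ p
        set c := ENNReal.ofReal (1 / ((k : ℕ) : ℝ) * (1 + Real.log (k : ℕ)) ^ (-(Q / p))) with hc
        have h3 : (∑ j ∈ Finset.Icc 1 (k : ℕ),
            seqRearrangement (UnitAddTorus.mFourierCoeff f) j ^ p') ^ (Q / p') ≤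
            D * (((k : ℕ) : ℝ≥0∞) ^ (Q / p') * I ^ Q + J ^ (Q / p)) := by
          have h4 := ENNReal.rpow_le_rpow (hC f hf k k.pos) (show 0 ≤ Q by linarith)
          rw [← ENNReal.rpow_mul, one_div_mul_eq_div] at h4
          refine h4.trans ?_
          rw [ENNReal.mul_rpow_of_nonneg _ _ (by linarith), hD, mul_assoc]
          gcongr
          refine (ENNReal.rpow_add_le_mul_rpow_add_rpow _ _ hQ1.le).trans (le_of_eq ?_)
          rw [ENNReal.mul_rpow_of_nonneg _ _ (by linarith), ← ENNReal.rpow_mul,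
            ← ENNReal.rpow_mul, one_div_mul_eq_div, one_div_mul_eq_div]
        have h5 : c * ((k : ℕ) : ℝ≥0∞) ^ (Q / p') ≤
            ENNReal.ofReal (((k : ℕ) : ℝ) ^ (Q / p' - 1)) := by
          rw [hc, ← ENNReal.ofReal_natCast, ENNReal.ofReal_rpow_of_pos hk0,
            ← ENNReal.ofReal_mul (by positivity)]
          refine ENNReal.ofReal_le_ofReal ?_
          rw [Real.rpow_sub_one hk0.ne']
          have h6 : (1 + Real.log (k : ℕ)) ^ (-(Q / p)) ≤ 1 :=
            Real.rpow_le_one_of_one_le_of_nonpos hL (by linarith)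
          calc 1 / ((k : ℕ) : ℝ) * (1 + Real.log (k : ℕ)) ^ (-(Q / p)) *
                ((k : ℕ) : ℝ) ^ (Q / p')
              ≤ 1 / ((k : ℕ) : ℝ) * 1 * ((k : ℕ) : ℝ) ^ (Q / p') := by gcongr
            _ = _ := by ring
        calc c * (∑ j ∈ Finset.Icc 1 (k : ℕ),
              seqRearrangement (UnitAddTorus.mFourierCoeff f) j ^ p') ^ (Q / p')
            ≤ c * (D * (((k : ℕ) : ℝ≥0∞) ^ (Q / p') * I ^ Q + J ^ (Q / p))) := by gcongr
          _ = D * (c * ((k : ℕ) : ℝ≥0∞) ^ (Q / p') * I ^ Q + c * J ^ (Q / p)) := by ring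
          _ ≤ _ := by gcongr
    _ ≤ D * (A * Φ + B * Φ) := by
        rw [ENNReal.tsum_mul_left, ENNReal.tsum_add]
        gcongr
    _ = _ := by
        rw [ENNReal.coe_mul, ENNReal.coe_toNNReal hDt, ENNReal.coe_add]
        ring

theorem HasFourierType.seqLorentzZygmundNorm_le {d : ℕ} {p : ℝ} (hp : 1 < p)
    (hX : HasFourierType X p d) {q : ℝ≥0∞} (hq : q ≠ ∞) (hpq : p < q.toReal) :
    ∃ C : ℝ≥0, ∀ f : UnitAddTorus (Fin d) → X, MemLorentz (torusMeasure d) p q f →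
      Integrable f (torusMeasure d) ∧
      seqLorentzZygmundNorm p.conjExponent q
          (-(1 / p) + ((max (ENNReal.ofReal p.conjExponent) q)⁻¹).toReal)
          (UnitAddTorus.mFourierCoeff f)
        ≤ C * lorentzNorm (torusMeasure d) p q f := by
  obtain ⟨C, hC⟩ := hX.tsum_partial_sums_le hp hpq
  have hconj := Real.HolderConjugate.conjExponent hp
  have hp' : 1 < p.conjExponent := hconj.symm.lt
  have hpp' : 1 - 1 / p.conjExponent = 1 / p := by
    have := hconj.inv_add_inv_eq_one
    rw [one_div, one_div]; linarith
  set p' := p.conjExponent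
  have hp0 : 0 < p := by linarith
  have hp'0 : 0 < p' := by linarith
  set Q := q.toReal with hQ
  have hQ0 : 0 < Q := by linarith
  have hQp : 1 < Q / p := by rwa [one_lt_div hp0]
  have hs0 : 0 < Q / p' := by positivity
  obtain ⟨A, hA⟩ := tsum_rpow_mul_lintegral_Ioo_le (q := Q) (θ := 1 / p') (by linarith)
    (by positivity)
  obtain ⟨B, hB⟩ := tsum_antitone_le_tsum_partial_sums hQp hs0
  -- The gain from summation by parts with `s = Q/p'`, divided by `Q`, is `1 / max(p', Q)`.
  have hexp : (-(1 / p) + ((max (ENNReal.ofReal p') q)⁻¹).toReal) * Q =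
      -(Q / p) + min (Q / p') 1 := by
    have h1 : ((max (ENNReal.ofReal p') q)⁻¹).toReal = (max p' Q)⁻¹ := by
      rw [ENNReal.toReal_inv, ENNReal.toReal_max ENNReal.ofReal_ne_top hq,
        ENNReal.toReal_ofReal hp'0.le]
    rw [h1, add_mul, neg_mul, one_div_mul_eq_div]
    congr 1
    rcases le_total p' Q with h | h
    · rw [max_eq_right h, min_eq_right (by rwa [one_le_div hp'0]), inv_mul_cancel₀ hQ0.ne']
    · rw [max_eq_left h, min_eq_left (by rwa [div_le_one hp'0]), inv_mul_eq_div]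
  refine ⟨(B * C) ^ (1 / Q), fun f hf => ?_⟩
  set μ := torusMeasure d
  have hnorm := lorentzNorm_eq_of_ne_top μ (p := p) hq f
  rw [← hQ] at hnorm
  set Φ := ∫⁻ t in Set.Ioo 0 1, rearrangement μ f t ^ Q * ENNReal.ofReal (t ^ (Q / p - 1)) with hΦ
  have hΦt : Φ < ∞ := by
    have h1 := hf.2
    rw [hnorm] at h1
    exact (ENNReal.rpow_lt_top_iff_of_pos (by positivity)).1 h1
  have hint : Integrable f μ := by
    refine integrable_of_lintegral_rearrangement_lt_top hf.1 ?_
    -- The term `k = 1` of the Hardy sum is the `Q`-th power of the integral of `f^*` over `(0, 1)`,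
    -- which yields integrability.
    have h1 := (ENNReal.le_tsum (1 : ℕ+)).trans (hA _ (measurable_rearrangement μ f))
    rw [hpp', mul_one_div Q p, PNat.one_coe, Nat.cast_one, Real.one_rpow, ENNReal.ofReal_one, one_mul,
      div_one] at h1
    exact (ENNReal.rpow_lt_top_iff_of_pos hQ0).1
      (h1.trans_lt (ENNReal.mul_lt_top ENNReal.coe_lt_top hΦt))
  refine ⟨hint, ?_⟩
  set x := seqRearrangement (UnitAddTorus.mFourierCoeff f) with hx
  have hxt : ∀ j, x j ≠ ∞ := fun j =>
    ((seqRearrangement_le_of_bound (enorm_mFourierCoeff_le f) j).trans_lt hint.2).ne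
  set a : ℕ → ℝ := fun j => (x j).toReal ^ p' with ha
  have hofa : ∀ j, ENNReal.ofReal (a j) = x j ^ p' := fun j => by
    rw [ha, ← ENNReal.ofReal_rpow_of_nonneg ENNReal.toReal_nonneg hp'0.le,
      ENNReal.ofReal_toReal (hxt j)]
  have ha0 : ∀ j, 0 ≤ a j := fun j => by positivity
  have hanti : Antitone a := fun i j hij => by
    have := ENNReal.toReal_mono (hxt i) (antitone_seqRearrangement _ hij)
    exact Real.rpow_le_rpow ENNReal.toReal_nonneg this hp'0.le
  have hsum : ∑' k : ℕ+, ENNReal.ofReal (((k : ℕ) : ℝ) ^ (Q / p' - 1) *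
      (1 + Real.log (k : ℕ)) ^ (-(Q / p) + min (Q / p') 1)) * x k ^ Q ≤ B * C * Φ := by
    calc ∑' k : ℕ+, ENNReal.ofReal (((k : ℕ) : ℝ) ^ (Q / p' - 1) *
          (1 + Real.log (k : ℕ)) ^ (-(Q / p) + min (Q / p') 1)) * x k ^ Q
        = ∑' k : ℕ+, ENNReal.ofReal (1 / ((k : ℕ) : ℝ) * ((k : ℕ) * a k) ^ (Q / p') *
          (1 + Real.log (k : ℕ)) ^ (-(Q / p) + min (Q / p') 1)) := by
          refine tsum_congr fun k => ?_
          have hk0 : (0 : ℝ) < (k : ℕ) := by exact_mod_cast k.pos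
          have hL := one_le_one_add_log (k := k)
          have h1 : x k ^ Q = ENNReal.ofReal (a k ^ (Q / p')) := by
            rw [← ENNReal.ofReal_rpow_of_nonneg (ha0 k) hs0.le, hofa, ← ENNReal.rpow_mul,
              mul_div_cancel₀ Q hp'0.ne']
          rw [h1, ← ENNReal.ofReal_mul (by positivity), Real.mul_rpow hk0.le (ha0 k),
            Real.rpow_sub_one hk0.ne']
          congr 1
          ring
      _ ≤ B * ∑' k : ℕ+, ENNReal.ofReal (1 / ((k : ℕ) : ℝ) * (1 + Real.log (k : ℕ)) ^ (-(Q / p)) *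
          (∑ j ∈ Finset.Icc 1 (k : ℕ), a j) ^ (Q / p')) := hB a ha0 hanti
      _ = B * ∑' k : ℕ+, ENNReal.ofReal (1 / ((k : ℕ) : ℝ) *
          (1 + Real.log (k : ℕ)) ^ (-(Q / p))) *
          (∑ j ∈ Finset.Icc 1 (k : ℕ), x j ^ p') ^ (Q / p') := by
          congr 1
          refine tsum_congr fun k => ?_
          have hL := one_le_one_add_log (k := k)
          rw [ENNReal.ofReal_mul (by positivity), ← ENNReal.ofReal_rpow_of_nonneg
            (Finset.sum_nonneg fun j _ => ha0 j) hs0.le,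
            ENNReal.ofReal_sum_of_nonneg fun j _ => ha0 j]
          simp only [hofa]
      _ ≤ B * (C * Φ) := by gcongr; exact hC f hf.1
      _ = B * C * Φ := by ring
  rw [seqLorentzZygmundNorm_eq_of_ne_top hq, ← hQ, hexp, hnorm,
    ENNReal.coe_rpow_of_nonneg _ (by positivity), ENNReal.coe_mul,
    ← ENNReal.mul_rpow_of_nonneg _ _ (by positivity)]
  exact ENNReal.rpow_le_rpow hsum (by positivity)

/-- The restriction `p ≤ 2` gives `p ≤ p'`, so the gain never exceeds the loss `1/p`; the
logarithmic weight is then non-increasing, as the pointwise bound requires. -/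
theorem neg_one_div_add_inv_max_nonpos {p : ℝ} (hp : 1 < p) (hp2 : p ≤ 2) (q : ℝ≥0∞) :
    -(1 / p) + ((max (ENNReal.ofReal p.conjExponent) q)⁻¹).toReal ≤ 0 := by
  have hp' : p ≤ p.conjExponent := by
    rw [Real.conjExponent, le_div_iff₀ (by linarith)]
    nlinarith
  have h1 : (max (ENNReal.ofReal p.conjExponent) q)⁻¹ ≤ (ENNReal.ofReal p)⁻¹ :=
    ENNReal.inv_le_inv.2 (le_max_of_le_left (ENNReal.ofReal_le_ofReal hp'))
  have h2 := ENNReal.toReal_mono (by simpa using (by linarith : 0 < p)) h1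
  rw [ENNReal.toReal_inv (ENNReal.ofReal p), ENNReal.toReal_ofReal (by linarith)] at h2
  rw [one_div]
  linarith

end Main

theorem mainTheorem4 {X : Type*} [NormedAddCommGroup X] [NormedSpace ℂ X] [CompleteSpace X]
    (d : ℕ) (hd : 1 ≤ d) (p₀ : ℝ) (hp₀ : 1 < p₀) (hp₀' : p₀ ≤ 2)
    (hX : HasFourierType X p₀ d) (q : ℝ≥0∞) (hq : ENNReal.ofReal p₀ < q) :
    (∃ C : ℝ≥0, ∀ f : UnitAddTorus (Fin d) → X, MemLorentz (torusMeasure d) p₀ q f →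
      Integrable f (torusMeasure d) ∧
      seqLorentzZygmundNorm p₀.conjExponent q
          (-(1 / p₀) + ((max (ENNReal.ofReal p₀.conjExponent) q)⁻¹).toReal)
          (UnitAddTorus.mFourierCoeff f)
        ≤ C * lorentzNorm (torusMeasure d) p₀ q f) ∧
    (∃ C : ℝ≥0, ∀ f : UnitAddTorus (Fin d) → X, MemLorentz (torusMeasure d) p₀ q f →
      ∀ n : ℕ, 1 ≤ n →
        seqRearrangement (UnitAddTorus.mFourierCoeff f) n
          ≤ C * ENNReal.ofReal ((n : ℝ) ^ (-(1 / p₀.conjExponent)) *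
              (1 + Real.log n) ^ (1 / p₀ - ((max (ENNReal.ofReal p₀.conjExponent) q)⁻¹).toReal))
            * lorentzNorm (torusMeasure d) p₀ q f) := by
  have hp' : 0 < p₀.conjExponent :=
    one_pos.trans (Real.HolderConjugate.conjExponent hp₀).symm.lt
  have hmain : ∃ C : ℝ≥0, ∀ f : UnitAddTorus (Fin d) → X, MemLorentz (torusMeasure d) p₀ q f →
      Integrable f (torusMeasure d) ∧
      seqLorentzZygmundNorm p₀.conjExponent q
          (-(1 / p₀) + ((max (ENNReal.ofReal p₀.conjExponent) q)⁻¹).toReal)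
          (UnitAddTorus.mFourierCoeff f)
        ≤ C * lorentzNorm (torusMeasure d) p₀ q f := by
    rcases eq_or_ne q ∞ with rfl | hqt
    -- Here the inverse of the maximum is `∞⁻¹ = 0`, so the logarithmic exponent is `-(1 / p₀)`.
    · simpa using hX.seqLorentzZygmundNorm_top_le hp₀
    · exact hX.seqLorentzZygmundNorm_le hp₀ hqt
        ((ENNReal.ofReal_lt_iff_lt_toReal (by linarith) hqt).1 hq)
  refine ⟨hmain, ?_⟩
  obtain ⟨C, hC⟩ := hmain
  set b := -(1 / p₀) + ((max (ENNReal.ofReal p₀.conjExponent) q)⁻¹).toReal with hb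
  obtain ⟨D, hD⟩ := exists_seqRearrangement_le_seqLorentzZygmundNorm (d := d) (X := X) hp'
    (neg_one_div_add_inv_max_nonpos hp₀ hp₀' q) (pos_of_gt hq).ne'
  refine ⟨D * C, fun f hf n hn => ?_⟩
  have hn0 : (0 : ℝ) < n := by exact_mod_cast hn
  have hL : 0 < 1 + Real.log n := one_pos.trans_le one_le_one_add_log
  have h1 := (hD (UnitAddTorus.mFourierCoeff f) n hn).trans (mul_le_mul_right (hC f hf).2 _)
  rw [show 1 / p₀ - ((max (ENNReal.ofReal p₀.conjExponent) q)⁻¹).toReal = -b by rw [hb]; ring]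
  calc seqRearrangement (UnitAddTorus.mFourierCoeff f) n
      = ENNReal.ofReal ((n : ℝ) ^ (-(1 / p₀.conjExponent)) * (1 + Real.log n) ^ (-b)) *
        (ENNReal.ofReal ((n : ℝ) ^ (1 / p₀.conjExponent) * (1 + Real.log n) ^ b) *
          seqRearrangement (UnitAddTorus.mFourierCoeff f) n) := by
        rw [← mul_assoc, ← ENNReal.ofReal_mul (by positivity), mul_mul_mul_comm,
          ← Real.rpow_add hn0, ← Real.rpow_add hL, neg_add_cancel, neg_add_cancel,
          Real.rpow_zero, Real.rpow_zero, mul_one, ENNReal.ofReal_one, one_mul]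
    _ ≤ ENNReal.ofReal ((n : ℝ) ^ (-(1 / p₀.conjExponent)) * (1 + Real.log n) ^ (-b)) *
        (D * (C * lorentzNorm (torusMeasure d) p₀ q f)) := by gcongr
    _ = _ := by
        rw [ENNReal.coe_mul]
        ring
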